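/- All logarithms are to base $2$. A \emph{biregular irreducible function} is a map $f:\mathcal S\times\mathcal X\to\mathcal N$ on finite nonempty sets together with a regularity set $\mathcal M\subseteq\mathcal N$ and integers $d_{\mathcal S},d_{\mathcal X}\ge 1$ such that for every $m\in\mathcal M$: $|\{x:f(s,x)=m\}|=d_{\mathcal S}$ for all $s$, $|\{s:f(s,x)=m\}|=d_{\mathcal X}$ for all $x$, and the symmetric stochastic matrix $P_{f,m}(x,x')=|\{s:f(s,x)=f(s,x')=m\}|/(d_{\mathcal S}d_{\mathcal X})$ has second-largest eigenvalue modulus $\lambda_2(f,m)=\max(|\mu_2|,|\mu_{|\mathcal X|}|)<1$, where $\mu_1\ge\mu_2\ge\dots\ge\mu_{|\mathcal X|}$ are its eigenvalues. Let $\Gamma\ge 0$ and $\sigma_T^2,\sigma_U^2>0$. Let $T^n$ and $U^n$ be the blocklength-$n$ additive white Gaussian noise channels with noise variances $\sigma_T^2$ (to the intended receiver) and $\sigma_U^2$ (to the eavesdropper), with inputs restricted to $\{a\in\mathbb R^n:\|a\|^2\le n\Gamma\}$. A blocklength-$n$ error-correcting code with finite message set $\tilde{\mathcal X}_n$ is a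 pair $(\phi_n,\psi_n)$ of an encoder $\phi_n$ assigning to each message a probability distribution on permissible inputs and a measurable decoder $\psi_n:\mathbb R^n\to\tilde{\mathcal X}_n$; $e(\phi_n,\psi_n)$ is its maximal error probability over $T^n$. For $f:\mathcal S\times\mathcal X\to\mathcal N$ as above and a code $(\phi,\psi)$ with message set $\mathcal X$, the modular BRI scheme $\Pi(f,\phi,\psi)$ has message set $\mathcal M$ and seed set $\mathcal S$; for seed $s$, a message $m$ is encoded by choosing $x$ uniformly from $\{x:f(s,x)=m\}$ and applying $\phi$, and a channel output $y$ is decoded as $f(s,\psi(y))$. Its error probability $e(\Pi)$ is the maximum over $s$ and $m$ of the decoding error probability over $T^n$, and its semantic security leakage is $L_{\mathrm{sem}}(\Pi)=\max_{P_M}I(M\wedge Z,S)$, where $M\sim P_M$ on $\mathcal M$, $S$ is uniform on $\mathcal S$ and independent of $M$, and $Z$ is the output of $U^n$ when $M$ is encoded with seed $S$. \textbf{Lemma.} Let $r\ge 0$, $0\le t<1$, and let $(f_n:\mathcal S_n\times\mathcal X_n\to\mathcal N_n)_{n\ge 1}$ be biregular irreducible functions with regularity sets $\mathcal M_n$ such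 that \[ \lim_{n\to\infty}\frac{\log|\mathcal X_n|}{n}=r,\qquad \lim_{n\to\infty}\frac{\log|\mathcal M_n|}{\log|\mathcal X_n|}=1-t,\qquad \liminf_{n\to\infty}\frac{\min_{m\in\mathcal M_n}(-\log\lambda_2(f_n,m))}{\log|\mathcal X_n|}\ge t . \] Let $(\phi_n,\psi_n)$ be blocklength-$n$ codes with message sets $\tilde{\mathcal X}_n$, $\liminf_n\frac1n\log|\tilde{\mathcal X}_n|>r$ and $e(\phi_n,\psi_n)\to 0$. Suppose \[ tr>\tfrac12\log\Bigl(1+\frac{\Gamma}{\sigma_U^2}\Bigr). \] Then for all large $n$ the set $\mathcal X_n$ can be embedded in $\tilde{\mathcal X}_n$. For every choice of such embeddings, with $\phi_n$ restricted to $\mathcal X_n$ and with any values in $\mathcal X_n$ assigned to decoder outputs outside $\mathcal X_n$, the modular BRI schemes $\Pi_n=\Pi(f_n,\phi_n,\psi_n)$ achieve the rate $(1-t)r$ with semantic security and exponentially decreasing leakage: \[ \liminf_{n\to\infty}\frac{\log|\mathcal M_n|}{n}\ge(1-t)r,\qquad \lim_{n\to\infty}e(\Pi_n)=0, \] and there is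 $\kappa>0$ with $L_{\mathrm{sem}}(\Pi_n)\le 2^{-\kappa n}$ for all sufficiently large $n$ (in particular $L_{\mathrm{sem}}(\Pi_n)\to 0$). -/

import Mathlib

open MeasureTheory ProbabilityTheory Filter Topology
open scoped NNReal ENNReal

noncomputable section

namespace Wiretap

/-! ### Logarithms and mutual information -/

/-- The logarithm to base `2` of a nonnegative real number, with `log 0 = -∞`. -/
def elog2 (x : ℝ) : EReal := if x = 0 then ⊥ else ((Real.logb 2 x : ℝ) : EReal)

/-- The mutual information in bits of the two components of a pair with joint law `μ`:
the Kullback-Leibler divergence, to base `2`, of `μ` and the product of its marginals. -/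
def mutualInfo {α β : Type*} [MeasurableSpace α] [MeasurableSpace β] (μ : Measure (α × β)) :
    ℝ≥0∞ :=
  InformationTheory.klDiv μ (μ.fst.prod μ.snd) / ENNReal.ofReal (Real.log 2)

/-! ### Biregular irreducible functions -/

/-- The second-largest eigenvalue modulus `max (|μ₂|, |μ_k|)` of a real symmetric `k × k` matrix
with eigenvalues `μ₁ ≥ ⋯ ≥ μ_k`, counted with multiplicity (`0` if there is no second
eigenvalue). -/
def secondEigenvalueModulus {X : Type*} [Fintype X] [DecidableEq X] {A : Matrix X X ℝ}
    (hA : A.IsHermitian) : ℝ :=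
  if h : 1 < Fintype.card X then
    max |hA.eigenvalues₀ ⟨1, h⟩| |hA.eigenvalues₀ ⟨Fintype.card X - 1, by omega⟩|
  else 0

section BRI

variable {S X N : Type*} [Fintype S] [DecidableEq N]

/-- The matrix `P_{f,m}(x,x') = |{s : f(s,x) = f(s,x') = m}| / (d_S d_X)`. -/
def transitionMatrix (f : S → X → N) (dS dX : ℕ) (m : N) : Matrix X X ℝ :=
  Matrix.of fun x x' =>
    ((Finset.univ.filter fun s => f s x = m ∧ f s x' = m).card : ℝ) / ((dS : ℝ) * (dX : ℝ))

theorem transitionMatrix_isHermitian (f : S → X → N) (dS dX : ℕ) (m : N) :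
    (transitionMatrix f dS dX m).IsHermitian := by
  ext x x'
  simp [transitionMatrix, and_comm]

/-- The second-largest eigenvalue modulus of `P_{f,m}`. -/
def lambda2 [Fintype X] [DecidableEq X] (f : S → X → N) (dS dX : ℕ) (m : N) : ℝ :=
  secondEigenvalueModulus (transitionMatrix_isHermitian f dS dX m)

end BRI

/-- A biregular irreducible function `f : S × X → N` together with a regularity set. -/
structure BRIFunction (S X N : Type*) [Fintype S] [Fintype X] [DecidableEq X]
    [DecidableEq N] where
  f : S → X → N
  regSet : Finset N
  dS : ℕ
  dX : ℕ
  dS_pos : 0 < dS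
  dX_pos : 0 < dX
  regular_S : ∀ m ∈ regSet, ∀ s, (Finset.univ.filter fun x => f s x = m).card = dS
  regular_X : ∀ m ∈ regSet, ∀ x, (Finset.univ.filter fun s => f s x = m).card = dX
  irreducible : ∀ m ∈ regSet, lambda2 f dS dX m < 1

/-- `λ₂(f,m)`. -/
def BRIFunction.lam {S X N : Type*} [Fintype S] [Fintype X] [DecidableEq X] [DecidableEq N]
    (F : BRIFunction S X N) (m : N) : ℝ :=
  lambda2 F.f F.dS F.dX m

/-! ### Error-correcting codes and seeded wiretap codes -/

/-- An error-correcting code with message set `X` for channels with input alphabet `A` and output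
alphabet `Y`: a stochastic encoder and a deterministic decoder. -/
structure ECCode (X A Y : Type*) [MeasurableSpace A] [MeasurableSpace Y] where
  enc : X → Measure A
  enc_prob : ∀ x, IsProbabilityMeasure (enc x)
  dec : Y → X
  dec_meas : ∀ B : Set X, MeasurableSet (dec ⁻¹' B)

/-- The maximal error probability of an error-correcting code over the channel `T`. -/
def ECCode.error {X A Y : Type*} [MeasurableSpace A] [MeasurableSpace Y]
    (T : Kernel A Y) (c : ECCode X A Y) : ℝ≥0∞ :=
  ⨆ x : X, ((c.enc x).bind T) {y | c.dec y ≠ x}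

/-- The code obtained from a code with message set `K` by using only the messages `ι x`, `x : X`,
where the decoder's decision in `K` is translated to `X` by `ρ`, a left inverse of `ι`. -/
def ECCode.restrict {K X A Y : Type*} [MeasurableSpace A] [MeasurableSpace Y]
    (c : ECCode K A Y) (ι : X → K) (ρ : K → X) : ECCode X A Y where
  enc x := c.enc (ι x)
  enc_prob x := c.enc_prob (ι x)
  dec y := ρ (c.dec y)
  dec_meas B := c.dec_meas (ρ ⁻¹' B)

/-- A seeded wiretap code with seed set `S` and message set `msgs`.  The decoder may also give
values outside the message set; these count as errors. -/
structure SeededCode (S N A Y : Type*) [MeasurableSpace A] where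
  msgs : Finset N
  enc : S → N → Measure A
  enc_prob : ∀ s, ∀ m ∈ msgs, IsProbabilityMeasure (enc s m)
  dec : S → Y → N

section SeededCode

variable {S N A Y Z : Type*} [MeasurableSpace A] [MeasurableSpace Y] [MeasurableSpace Z]

/-- The maximal error probability of a seeded wiretap code over the channel `T` to the intended
receiver. -/
def SeededCode.error (T : Kernel A Y) (c : SeededCode S N A Y) : ℝ≥0∞ :=
  ⨆ s : S, ⨆ m : {m // m ∈ c.msgs}, ((c.enc s m).bind T) {y | c.dec s y ≠ m}

/-- The joint law of `(M, (Z, S))`, where the message `M` has law `p`, the seed `S` is uniform and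
independent of `M`, and `Z` is generated by `S` and `M` via the encoder followed by `U`.  The
finite sets of messages and of seeds carry the discrete sigma-algebra. -/
def SeededCode.jointLaw [Fintype S] (U : Kernel A Z) (c : SeededCode S N A Y)
    (p : PMF {m // m ∈ c.msgs}) :
    @Measure ({m // m ∈ c.msgs} × (Z × S))
      (@Prod.instMeasurableSpace _ _ ⊤ (@Prod.instMeasurableSpace _ _ _ ⊤)) :=
  letI : MeasurableSpace S := ⊤
  letI : MeasurableSpace {m // m ∈ c.msgs} := ⊤
  ∑ m, ∑ s : S, (p m * (Fintype.card S : ℝ≥0∞)⁻¹) •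
    (Measure.dirac m).prod (((c.enc s m).bind U).prod (Measure.dirac s))

/-- The semantic security information leakage `max_{P_M} I(M ∧ Z,S)`, in bits. -/
def SeededCode.leakage [Fintype S] (U : Kernel A Z) (c : SeededCode S N A Y) : ℝ≥0∞ :=
  letI : MeasurableSpace S := ⊤
  letI : MeasurableSpace {m // m ∈ c.msgs} := ⊤
  ⨆ p : PMF {m // m ∈ c.msgs}, mutualInfo (c.jointLaw U p)

end SeededCode

/-- The modular BRI scheme `Π(f, φ, ψ)`: the message set is the regularity set, the encoder applies
the randomized inverse of `f(s, ·)`, which is uniform on `{x : f(s,x) = m}`, followed by `φ`, and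
the decoder is `f(s, ψ(y))`. -/
def modularBRIScheme {S X N A Y : Type*} [Fintype S] [Fintype X] [DecidableEq X] [DecidableEq N]
    [MeasurableSpace A] [MeasurableSpace Y] (F : BRIFunction S X N) (c : ECCode X A Y) :
    SeededCode S N A Y where
  msgs := F.regSet
  enc s m := ∑ x ∈ Finset.univ.filter (fun x => F.f s x = m), (F.dS : ℝ≥0∞)⁻¹ • c.enc x
  enc_prob s m hm := by
    constructor
    have h : ∀ x, c.enc x Set.univ = 1 := fun x => (c.enc_prob x).measure_univ
    simp only [Measure.coe_finsetSum, Finset.sum_apply, Measure.smul_apply, h, smul_eq_mul,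
      mul_one, Finset.sum_const, F.regular_S m hm s, nsmul_eq_mul]
    exact ENNReal.mul_inv_cancel (by exact_mod_cast F.dS_pos.ne') (ENNReal.natCast_ne_top _)
  dec s y := F.f s (c.dec y)

/-! ### Gaussian wiretap channels -/

/-- The blocklength-`n` memoryless extension of the additive Gaussian noise channel with noise
variance `v`. -/
def gaussianChannel (v : ℝ≥0) (n : ℕ) : Kernel (Fin n → ℝ) (Fin n → ℝ) where
  toFun a := Measure.pi fun i => gaussianReal (a i) v
  measurable' := by
    refine Measurable.measure_of_isPiSystem_of_isProbabilityMeasure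
      generateFrom_pi.symm isPiSystem_pi ?_
    rintro _ ⟨B, hB, rfl⟩
    simp only [Measure.pi_pi]
    refine Finset.measurable_prod _ fun i _ => ?_
    have h : Measurable fun x : ℝ => gaussianReal x v :=
      measurable_gaussianReal.comp (measurable_id.prodMk measurable_const)
    have hBi : MeasurableSet (B i) := hB i (Set.mem_univ i)
    exact ((Measure.measurable_coe hBi).comp h).comp (measurable_pi_apply i)

/-- The permissible inputs of blocklength `n` under the input power constraint `Γ`: the closed
Euclidean ball of squared radius `n Γ`. -/
abbrev PowerBall (Γ : ℝ) (n : ℕ) : Type := {a : Fin n → ℝ // ∑ i, a i ^ 2 ≤ n * Γ}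

/-- The Gaussian channel of blocklength `n` with inputs restricted to the permissible ones. -/
def gaussianChannelOn (v : ℝ≥0) (Γ : ℝ) (n : ℕ) : Kernel (PowerBall Γ n) (Fin n → ℝ) :=
  (gaussianChannel v n).comap Subtype.val measurable_subtype_coe

/-! ### Asymptotic notions -/

/-- A sequence of blocklength-`n` seeded wiretap codes for the Gaussian wiretap channel with noise
variances `vT` and `vU` and input power constraint `Γ` achieves the rate `R` with semantic
security. -/
def AchievesSemSecRate (vT vU : ℝ≥0) (Γ : ℝ) {S N : ℕ → Type*} [∀ n, Fintype (S n)]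
    (c : ∀ n, SeededCode (S n) (N n) (PowerBall Γ n) (Fin n → ℝ)) (R : ℝ) : Prop :=
  (R : EReal) ≤ liminf (fun n : ℕ => elog2 ((c n).msgs.card : ℝ) / (n : EReal)) atTop ∧
  Tendsto (fun n => (c n).error (gaussianChannelOn vT Γ n)) atTop (𝓝 0) ∧
  Tendsto (fun n => (c n).leakage (gaussianChannelOn vU Γ n)) atTop (𝓝 0)

/-- The semantic security leakage of the codes decreases exponentially in the blocklength. -/
def LeakageDecaysExponentially (vU : ℝ≥0) (Γ : ℝ) {S N : ℕ → Type*} [∀ n, Fintype (S n)]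
    (c : ∀ n, SeededCode (S n) (N n) (PowerBall Γ n) (Fin n → ℝ)) : Prop :=
  ∃ κ : ℝ, 0 < κ ∧ ∀ᶠ n : ℕ in atTop,
    (c n).leakage (gaussianChannelOn vU Γ n) ≤ ENNReal.ofReal ((2 : ℝ) ^ (-(κ * (n : ℝ))))

/-- The blocklength-`n` error-correcting codes, with message sets `K n`, achieve a rate strictly
larger than `r` on the Gaussian channel with noise variance `vT` and input power constraint `Γ`. -/
def AchievesRateAbove (vT : ℝ≥0) (Γ : ℝ) {K : ℕ → Type*} [∀ n, Fintype (K n)]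
    (c : ∀ n, ECCode (K n) (PowerBall Γ n) (Fin n → ℝ)) (r : ℝ) : Prop :=
  (r : EReal) < liminf (fun n : ℕ => elog2 (Fintype.card (K n) : ℝ) / (n : EReal)) atTop ∧
  Tendsto (fun n => (c n).error (gaussianChannelOn vT Γ n)) atTop (𝓝 0)

end Wiretap

end

/-!
The leakage for every blocklength is bounded by a sum of two terms, one governed by the spectral gap
of the biregular irreducible function and one by a large deviation of the information density.

Let `w x` be the density of the eavesdropper's output for the message `x` of the error-correcting
code, with respect to a fixed probability measure.  In the modular scheme with seed `s` and message
`m`, the output density is the mean of the `w x` over the fibre `{x | f s x = m}`, and by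
biregularity its average over the seeds is the overall mean `Q` of the `w x`, which does not depend
on `m`.  By the convexity of relative entropy, the leakage is therefore at most the maximum over `m`
of the seed average of the divergence between the fibre mean and `Q`
(`IsSeededDensity.klDiv_seededLaw_le`).  All inequalities between divergences hold pointwise in the
output, for the nonnegative integrand `relEntropy a b = a log (a / b) + b - a`, so that no
integrability has to be checked.

Split `w x = u x + v x` with `u x ≤ B`.  By the log-sum inequality the two parts can be treated
separately.  For `u`, relative entropy is bounded by the `χ²` divergence, whose seed average is a
quadratic form in the matrix `P_{f,m}`.  This matrix has row sums `1` and second eigenvalue modulus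
`λ < 1`, so that the constants span its top eigenspace and the average is at most `λ B`
(`dotProduct_mulVec_le_of_mulVec_one`, `BRIFunction.sum_relEntropy_fibre_mean_le_lam_mul`).  For `v`,
a fibre mean is at most `|X|` times the overall mean, so that a mass `ε` of `v` costs at most
`ε log |X|` (`BRIFunction.sum_relEntropy_fibre_mean_le_mul_log`).

For the Gaussian channel of noise variance `σ²`, the reference measure is the centred normal law of
variance `σ² + Γ` in each coordinate, and the splitting is at the value `n (C + δ)` of the
information density, where `C = log (1 + Γ / σ²) / 2`.  Then `B = e^{n (C + δ)}`, and a Chernoff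
bound, whose Gaussian integral is found by completing the square, gives `ε ≤ e^{-n δ² / 2}` for all
inputs of power at most `Γ` (`exists_bind_gaussianChannelOn_eq_withDensity_add`).  Since `λ` is
about `|X|^{-t}`, that is `2^{-n t r}`, and `t r` exceeds the capacity `C / log 2`, both terms decay
exponentially.  The error probability of the scheme is at most that of the code, and the rate is a
product of two limits.
-/

namespace Wiretap

open Matrix InformationTheory

/-! ### The quadratic form of a symmetric matrix with a spectral gap -/

section Spectral

variable {X : Type*} [Fintype X] [DecidableEq X] {A : Matrix X X ℝ}

theorem secondEigenvalueModulus_nonneg (hA : A.IsHermitian) : 0 ≤ secondEigenvalueModulus hA := by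
  unfold secondEigenvalueModulus
  split_ifs
  · exact le_max_of_le_left (abs_nonneg _)
  · exact le_rfl

/-- The exceptional index is that of the largest eigenvalue. -/
theorem exists_forall_ne_eigenvalues_le_secondEigenvalueModulus [Nonempty X]
    (hA : A.IsHermitian) :
    ∃ i₀, ∀ i, i ≠ i₀ → hA.eigenvalues i ≤ secondEigenvalueModulus hA := by
  let e : Fin (Fintype.card X) ≃ X := Fintype.equivOfCardEq (Fintype.card_fin _)
  refine ⟨e ⟨0, Fintype.card_pos⟩, fun i hi => ?_⟩
  have h0 : (e.symm i : ℕ) ≠ 0 := fun h => hi <| by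
    rw [← e.apply_symm_apply i]
    exact congrArg e (Fin.ext h)
  have h1 : 1 < Fintype.card X := by have := (e.symm i).isLt; omega
  have h2 : hA.eigenvalues i ≤ hA.eigenvalues₀ ⟨1, h1⟩ :=
    hA.eigenvalues₀_antitone (show (⟨1, h1⟩ : Fin _) ≤ e.symm i from Fin.le_def.2 (by
      change 1 ≤ (e.symm i : ℕ); omega))
  unfold secondEigenvalueModulus
  rw [dif_pos h1]
  exact h2.trans ((le_abs_self _).trans (le_max_left _ _))

theorem sum_dotProduct_eigenvectorBasis_mul (hA : A.IsHermitian) (u w : X → ℝ) :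
    ∑ i, (⇑(hA.eigenvectorBasis i) ⬝ᵥ u) * (⇑(hA.eigenvectorBasis i) ⬝ᵥ w) = u ⬝ᵥ w := by
  have h := hA.eigenvectorBasis.sum_inner_mul_inner (WithLp.toLp 2 u) (WithLp.toLp 2 w)
  simp only [EuclideanSpace.inner_eq_star_dotProduct, star_trivial] at h
  rw [dotProduct_comm u w, ← h]
  refine Finset.sum_congr rfl fun i _ => ?_
  rw [dotProduct_comm _ w]

theorem eigenvectorBasis_dotProduct_mulVec (hA : A.IsHermitian) (i : X) (u : X → ℝ) :
    ⇑(hA.eigenvectorBasis i) ⬝ᵥ (A *ᵥ u) =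
      hA.eigenvalues i * (⇑(hA.eigenvectorBasis i) ⬝ᵥ u) := by
  rw [dotProduct_mulVec, ← mulVec_transpose]
  have : Aᵀ = A := by simpa [conjTranspose_eq_transpose_of_trivial] using hA.eq
  rw [this, hA.mulVec_eigenvectorBasis, smul_dotProduct, smul_eq_mul]

/-- If all rows of a symmetric matrix sum to `1` and its second eigenvalue modulus `λ` is less
than `1`, then the constants span the top eigenspace, so that on their orthogonal complement the
quadratic form is at most `λ` times the squared norm. -/
theorem dotProduct_mulVec_le_of_mulVec_one [Nonempty X] (hA : A.IsHermitian)
    (h1 : A *ᵥ 1 = 1) (hlt : secondEigenvalueModulus hA < 1) (u : X → ℝ) :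
    u ⬝ᵥ (A *ᵥ u) ≤ (∑ x, u x) ^ 2 / Fintype.card X +
      secondEigenvalueModulus hA * ∑ x, u x ^ 2 := by
  obtain ⟨i₀, hi₀⟩ := exists_forall_ne_eigenvalues_le_secondEigenvalueModulus hA
  set l := secondEigenvalueModulus hA
  have hl : 0 ≤ l := secondEigenvalueModulus_nonneg hA
  set b : X → X → ℝ := fun i => ⇑(hA.eigenvectorBasis i)
  have hk : (0 : ℝ) < Fintype.card X := by exact_mod_cast Fintype.card_pos
  have hne : ∀ i, i ≠ i₀ → b i ⬝ᵥ 1 = 0 := fun i hi => by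
    have h := eigenvectorBasis_dotProduct_mulVec hA i 1
    rw [h1] at h
    have h' : (hA.eigenvalues i - 1) * (b i ⬝ᵥ 1) = 0 := by
      simp only [b]; linarith
    rcases mul_eq_zero.1 h' with h'' | h''
    · have := hi₀ i hi; linarith
    · exact h''
  -- Parseval against the constant vector leaves only the term of index `i₀`.
  have hone : ∀ w : X → ℝ, (b i₀ ⬝ᵥ 1) * (b i₀ ⬝ᵥ w) = ∑ x, w x := fun w => by
    have h := sum_dotProduct_eigenvectorBasis_mul hA 1 w
    rw [Finset.sum_eq_single i₀ (fun i _ hi => by rw [show _ = _ from hne i hi, zero_mul])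
      (by simp), one_dotProduct] at h
    exact h
  have hsq : (b i₀ ⬝ᵥ 1) ^ 2 = Fintype.card X := by
    rw [sq, hone]; simp
  have hev : hA.eigenvalues i₀ = 1 := by
    have h := eigenvectorBasis_dotProduct_mulVec hA i₀ 1
    rw [h1] at h
    have h0 : b i₀ ⬝ᵥ 1 ≠ 0 := fun h0 => by
      rw [h0, zero_pow two_ne_zero] at hsq
      exact hk.ne hsq
    exact (mul_right_cancel₀ h0 (by rw [one_mul]; exact h)).symm
  have hu : (b i₀ ⬝ᵥ u) ^ 2 = (∑ x, u x) ^ 2 / Fintype.card X := by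
    rw [eq_div_iff hk.ne', ← hsq, ← hone u]; ring
  have hnorm : ∑ i, (b i ⬝ᵥ u) ^ 2 = ∑ x, u x ^ 2 := by
    have h := sum_dotProduct_eigenvectorBasis_mul hA u u
    simp only [dotProduct, ← sq] at h ⊢
    exact h
  rw [← sum_dotProduct_eigenvectorBasis_mul hA u (A *ᵥ u), ← hu, ← hnorm, Finset.mul_sum,
    ← Finset.add_sum_erase _ _ (Finset.mem_univ i₀), eigenvectorBasis_dotProduct_mulVec, hev,
    ← Finset.add_sum_erase _ (fun i => l * (b i ⬝ᵥ u) ^ 2) (Finset.mem_univ i₀)]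
  have h2 : ∑ i ∈ Finset.univ.erase i₀, (⇑(hA.eigenvectorBasis i) ⬝ᵥ u) *
      (⇑(hA.eigenvectorBasis i) ⬝ᵥ (A *ᵥ u)) ≤
      ∑ i ∈ Finset.univ.erase i₀, l * (b i ⬝ᵥ u) ^ 2 := by
    refine Finset.sum_le_sum fun i hi => ?_
    rw [eigenvectorBasis_dotProduct_mulVec]
    have := mul_le_mul_of_nonneg_right (hi₀ i (Finset.ne_of_mem_erase hi)) (sq_nonneg (b i ⬝ᵥ u))
    calc _ = hA.eigenvalues i * (b i ⬝ᵥ u) ^ 2 := by simp only [b]; ring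
      _ ≤ _ := this
  have h3 := mul_nonneg hl (sq_nonneg (b i₀ ⬝ᵥ u))
  have h4 : (⇑(hA.eigenvectorBasis i₀) ⬝ᵥ u) * (1 * (⇑(hA.eigenvectorBasis i₀) ⬝ᵥ u)) =
    (b i₀ ⬝ᵥ u) ^ 2 := by simp only [b]; ring
  linarith

end Spectral

/-! ### Pointwise relative entropy -/

/-- The integrand `a log (a / b) + b - a` of the Kullback-Leibler divergence of two measures with
densities `a` and `b`, in nats.  It is only used where `b = 0` implies `a = 0`, and is `0` there. -/
noncomputable def relEntropy (a b : ℝ) : ℝ := b * klFun (a / b)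

theorem relEntropy_nonneg {a b : ℝ} (ha : 0 ≤ a) (hb : 0 ≤ b) : 0 ≤ relEntropy a b :=
  mul_nonneg hb (klFun_nonneg (div_nonneg ha hb))

theorem relEntropy_zero_right (a : ℝ) : relEntropy a 0 = 0 := by simp [relEntropy]

theorem relEntropy_eq {a b : ℝ} (hb : b ≠ 0) :
    relEntropy a b = a * Real.log a - a * Real.log b + b - a := by
  rcases eq_or_ne a 0 with rfl | ha
  · simp [relEntropy, klFun_zero]
  · rw [relEntropy, klFun_apply, Real.log_div ha hb]
    field_simp

/-- The log-sum inequality. -/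
theorem relEntropy_add_le {a₁ a₂ b₁ b₂ : ℝ} (ha₁ : 0 ≤ a₁) (ha₂ : 0 ≤ a₂) (hb₁ : 0 ≤ b₁)
    (hb₂ : 0 ≤ b₂) (h₁ : b₁ = 0 → a₁ = 0) (h₂ : b₂ = 0 → a₂ = 0) :
    relEntropy (a₁ + a₂) (b₁ + b₂) ≤ relEntropy a₁ b₁ + relEntropy a₂ b₂ := by
  rcases hb₁.eq_or_lt with h | hb₁'
  · simp [← h, h₁ h.symm, relEntropy_zero_right]
  rcases hb₂.eq_or_lt with h | hb₂'
  · simp [← h, h₂ h.symm, relEntropy_zero_right]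
  have hb : 0 < b₁ + b₂ := by positivity
  have h := convexOn_klFun.2 (Set.mem_Ici.2 (div_nonneg ha₁ hb₁))
    (Set.mem_Ici.2 (div_nonneg ha₂ hb₂)) (show 0 ≤ b₁ / (b₁ + b₂) by positivity)
    (show 0 ≤ b₂ / (b₁ + b₂) by positivity) (by field_simp)
  simp only [smul_eq_mul] at h
  have e : b₁ / (b₁ + b₂) * (a₁ / b₁) + b₂ / (b₁ + b₂) * (a₂ / b₂) =
      (a₁ + a₂) / (b₁ + b₂) := by field_simp
  rw [e] at h
  calc relEntropy (a₁ + a₂) (b₁ + b₂)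
      ≤ (b₁ + b₂) * (b₁ / (b₁ + b₂) * klFun (a₁ / b₁) + b₂ / (b₁ + b₂) * klFun (a₂ / b₂)) :=
        mul_le_mul_of_nonneg_left h hb.le
    _ = _ := by unfold relEntropy; field_simp

/-- The pointwise form of the bound of the Kullback-Leibler divergence by the `χ²` divergence. -/
theorem relEntropy_le_sq_div {a b : ℝ} (ha : 0 ≤ a) (hb : 0 < b) :
    relEntropy a b ≤ a ^ 2 / b - 2 * a + b := by
  have h : klFun (a / b) ≤ (a / b) ^ 2 - 2 * (a / b) + 1 := by
    rw [klFun_apply]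
    rcases (div_nonneg ha hb.le).eq_or_lt with h | h
    · simp [← h]
    · have := mul_le_mul_of_nonneg_left (Real.log_le_sub_one_of_pos h) h.le
      nlinarith
  calc relEntropy a b ≤ b * ((a / b) ^ 2 - 2 * (a / b) + 1) := mul_le_mul_of_nonneg_left h hb.le
    _ = _ := by field_simp

theorem relEntropy_le_mul_log {a b C : ℝ} (ha : 0 ≤ a) (hb : 0 ≤ b) (hC : a ≤ C * b) :
    relEntropy a b ≤ a * Real.log C + b - a := by
  rcases hb.eq_or_lt with h | hb'
  · have : a = 0 := le_antisymm (by simpa [← h] using hC) ha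
    simp [← h, this, relEntropy_zero_right]
  rcases ha.eq_or_lt with h | ha'
  · simp [← h, relEntropy, klFun_zero]
  have h : Real.log (a / b) ≤ Real.log C :=
    Real.log_le_log (by positivity) ((div_le_iff₀ hb').2 hC)
  have := mul_le_mul_of_nonneg_left h ha
  rw [Real.log_div ha'.ne' hb'.ne'] at this
  rw [relEntropy_eq hb'.ne']
  linarith

/-- Among all second arguments, the mean of the first arguments minimizes the mean relative
entropy. -/
theorem sum_mul_relEntropy_mean_le {M : Type*} [Fintype M] {p P : M → ℝ} {Q : ℝ}
    (hp : ∀ m, 0 ≤ p m) (hp1 : ∑ m, p m = 1) (hP : ∀ m, 0 ≤ P m) (hQ : 0 ≤ Q)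
    (hac : Q = 0 → ∀ m, P m = 0) :
    ∑ m, p m * relEntropy (P m) (∑ m, p m * P m) ≤ ∑ m, p m * relEntropy (P m) Q := by
  rcases eq_or_ne (∑ m, p m * P m) 0 with h | h
  · simp only [h, relEntropy_zero_right, mul_zero, Finset.sum_const_zero]
    exact Finset.sum_nonneg fun m _ => mul_nonneg (hp m) (relEntropy_nonneg (hP m) hQ)
  have hQ0 : Q ≠ 0 := fun hQ0 => h (by simp [hac hQ0])
  have key : ∀ R : ℝ, R ≠ 0 → ∑ m, p m * relEntropy (P m) R =
      ∑ m, p m * (P m * Real.log (P m)) - (∑ m, p m * P m) * Real.log R + R -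
        ∑ m, p m * P m := fun R hR => by
    simp only [relEntropy_eq hR, mul_add, mul_sub, Finset.sum_add_distrib, Finset.sum_sub_distrib]
    rw [← Finset.sum_mul, hp1, one_mul, Finset.sum_mul]
    simp only [mul_assoc]
  have h0 : 0 ≤ relEntropy (∑ m, p m * P m) Q :=
    relEntropy_nonneg (Finset.sum_nonneg fun m _ => mul_nonneg (hp m) (hP m)) hQ
  rw [relEntropy_eq hQ0] at h0
  rw [key _ h, key _ hQ0]
  linarith

/-! ### Fibre means of biregular irreducible functions -/

section BRI

variable {S X N : Type*} [Fintype S] [Fintype X] [DecidableEq X] [DecidableEq N]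

theorem BRIFunction.lam_nonneg (F : BRIFunction S X N) (m : N) : 0 ≤ F.lam m :=
  secondEigenvalueModulus_nonneg _

/-- The fibre `{x : f(s,x) = m}`. -/
def BRIFunction.fibre (F : BRIFunction S X N) (s : S) (m : N) : Finset X :=
  Finset.univ.filter fun x => F.f s x = m

variable (F : BRIFunction S X N) {m : N}

theorem BRIFunction.sum_sum_fibre (hm : m ∈ F.regSet) (w : X → ℝ) :
    ∑ s, ∑ x ∈ F.fibre s m, w x = F.dX * ∑ x, w x := by
  simp only [fibre, Finset.sum_filter]
  rw [Finset.sum_comm, Finset.mul_sum]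
  refine Finset.sum_congr rfl fun x _ => ?_
  rw [← Finset.sum_filter, Finset.sum_const, F.regular_X m hm x, nsmul_eq_mul]

theorem BRIFunction.card_mul_dS (hm : m ∈ F.regSet) :
    (Fintype.card S : ℝ) * F.dS = Fintype.card X * F.dX := by
  have h := F.sum_sum_fibre hm (fun _ => 1)
  simp only [fibre, Finset.sum_const, F.regular_S m hm, nsmul_eq_mul, mul_one,
    Finset.card_univ] at h
  rw [h, mul_comm]

theorem BRIFunction.transitionMatrix_mulVec_one (hm : m ∈ F.regSet) :
    transitionMatrix F.f F.dS F.dX m *ᵥ 1 = 1 := by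
  have hS : (F.dS : ℝ) ≠ 0 := by exact_mod_cast F.dS_pos.ne'
  have hX : (F.dX : ℝ) ≠ 0 := by exact_mod_cast F.dX_pos.ne'
  ext x
  simp only [mulVec, dotProduct, transitionMatrix, of_apply, Pi.one_apply, mul_one,
    ← Finset.sum_div, Finset.card_filter, Nat.cast_sum, Nat.cast_ite, Nat.cast_one,
    Nat.cast_zero]
  rw [Finset.sum_comm, div_eq_one_iff_eq (mul_ne_zero hS hX)]
  have h : ∀ s, (∑ x', if F.f s x = m ∧ F.f s x' = m then (1 : ℝ) else 0) =
      if F.f s x = m then (F.dS : ℝ) else 0 := fun s => by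
    by_cases hx : F.f s x = m
    · simp [hx, F.regular_S m hm s]
    · simp [hx]
  simp only [h]
  rw [← Finset.sum_filter, Finset.sum_const, F.regular_X m hm x, nsmul_eq_mul, mul_comm]

theorem BRIFunction.sum_sq_sum_fibre (u : X → ℝ) :
    ∑ s, (∑ x ∈ F.fibre s m, u x) ^ 2 =
      F.dS * F.dX * (u ⬝ᵥ (transitionMatrix F.f F.dS F.dX m *ᵥ u)) := by
  have hS : (F.dS : ℝ) ≠ 0 := by exact_mod_cast F.dS_pos.ne'
  have hX : (F.dX : ℝ) ≠ 0 := by exact_mod_cast F.dX_pos.ne'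
  have h : ∀ s, (∑ x ∈ F.fibre s m, u x) ^ 2 =
      ∑ x, ∑ x', (if F.f s x = m ∧ F.f s x' = m then 1 else 0) * (u x * u x') := fun s => by
    simp only [fibre, Finset.sum_filter]
    rw [sq, Finset.sum_mul_sum]
    refine Finset.sum_congr rfl fun x _ => Finset.sum_congr rfl fun x' _ => ?_
    by_cases h1 : F.f s x = m <;> by_cases h2 : F.f s x' = m <;> simp [h1, h2]
  simp only [h]
  rw [Finset.sum_comm]
  simp only [dotProduct, mulVec, Finset.mul_sum]
  refine Finset.sum_congr rfl fun x _ => ?_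
  rw [Finset.sum_comm]
  refine Finset.sum_congr rfl fun x' _ => ?_
  simp only [transitionMatrix, of_apply, Finset.card_filter, Nat.cast_sum, Nat.cast_ite,
    Nat.cast_one, Nat.cast_zero]
  rw [← Finset.sum_mul]
  field_simp

/-- The `χ²` part of the leakage: averaged over the seed, the fibre means of `u` are close to the
overall mean of `u` by the spectral gap, as far as `u` is bounded. -/
theorem BRIFunction.sum_relEntropy_fibre_mean_le_lam_mul [Nonempty X] (hm : m ∈ F.regSet)
    {u : X → ℝ} (hu : ∀ x, 0 ≤ u x) {B : ℝ} (hB : ∀ x, u x ≤ B) :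
    ∑ s, relEntropy ((∑ x ∈ F.fibre s m, u x) / F.dS) ((∑ x, u x) / Fintype.card X) ≤
      Fintype.card S * (F.lam m * B) := by
  have hS : (0 : ℝ) < F.dS := by exact_mod_cast F.dS_pos
  have hX : (0 : ℝ) < F.dX := by exact_mod_cast F.dX_pos
  have hk : (0 : ℝ) < Fintype.card X := by exact_mod_cast Fintype.card_pos
  have hl := F.lam_nonneg m
  have hcard := F.card_mul_dS hm
  obtain ⟨x₀⟩ := ‹Nonempty X›
  have hB0 : 0 ≤ B := (hu x₀).trans (hB x₀)
  set Q := (∑ x, u x) / Fintype.card X with hQ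
  have hsum : ∑ x, u x = Fintype.card X * Q := by rw [hQ]; field_simp
  have hQnn : 0 ≤ Q := div_nonneg (Finset.sum_nonneg fun x _ => hu x) hk.le
  rcases hQnn.eq_or_lt with h | hQ0
  · simp only [← h, relEntropy_zero_right, Finset.sum_const_zero]
    positivity
  have : Nonempty X := ⟨x₀⟩
  have hspec := dotProduct_mulVec_le_of_mulVec_one (transitionMatrix_isHermitian F.f F.dS F.dX m)
    (F.transitionMatrix_mulVec_one hm) (F.irreducible m hm) u
  change _ ≤ _ + F.lam m * _ at hspec
  have hsq : ∑ x, u x ^ 2 ≤ B * (Fintype.card X * Q) := by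
    rw [← hsum, Finset.mul_sum]
    refine Finset.sum_le_sum fun x _ => ?_
    rw [sq]
    exact mul_le_mul_of_nonneg_right (hB x) (hu x)
  have hmean : ∑ s, (∑ x ∈ F.fibre s m, u x) / F.dS = Fintype.card S * Q := by
    rw [← Finset.sum_div, F.sum_sum_fibre hm, hsum, div_eq_iff hS.ne']
    linear_combination (-Q) * hcard
  calc _ ≤ ∑ s, (((∑ x ∈ F.fibre s m, u x) / F.dS) ^ 2 / Q -
          2 * ((∑ x ∈ F.fibre s m, u x) / F.dS) + Q) :=
        Finset.sum_le_sum fun s _ => relEntropy_le_sq_div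
          (div_nonneg (Finset.sum_nonneg fun x _ => hu x) hS.le) hQ0
    _ = (∑ s, (∑ x ∈ F.fibre s m, u x) ^ 2) / (F.dS ^ 2 * Q) - Fintype.card S * Q := by
        rw [Finset.sum_add_distrib, Finset.sum_sub_distrib, ← Finset.mul_sum, hmean,
          Finset.sum_const, Finset.card_univ, nsmul_eq_mul, Finset.sum_div]
        simp only [div_pow, div_div]
        ring
    _ ≤ F.dS * F.dX * ((Fintype.card X * Q) ^ 2 / Fintype.card X +
          F.lam m * (B * (Fintype.card X * Q))) / (F.dS ^ 2 * Q) - Fintype.card S * Q := by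
        rw [F.sum_sq_sum_fibre, ← hsum]
        rw [← hsum] at hsq
        gcongr
        exact hspec.trans (by gcongr)
    _ = Fintype.card S * (F.lam m * B) := by
        have e : (F.dX : ℝ) = Fintype.card S * F.dS / Fintype.card X := by
          rw [hcard]; field_simp
        rw [e]
        field_simp
        ring

/-- The contribution of an arbitrary remainder `v`. -/
theorem BRIFunction.sum_relEntropy_fibre_mean_le_mul_log [Nonempty X] (hm : m ∈ F.regSet)
    {v : X → ℝ} (hv : ∀ x, 0 ≤ v x) :
    ∑ s, relEntropy ((∑ x ∈ F.fibre s m, v x) / F.dS) ((∑ x, v x) / Fintype.card X) ≤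
      Fintype.card S * ((∑ x, v x) / Fintype.card X * Real.log (Fintype.card X)) := by
  have hS : (1 : ℝ) ≤ F.dS := by exact_mod_cast F.dS_pos
  have hk : (0 : ℝ) < Fintype.card X := by exact_mod_cast Fintype.card_pos
  have hcard := F.card_mul_dS hm
  set Q := (∑ x, v x) / Fintype.card X with hQ
  have hsum : ∑ x, v x = Fintype.card X * Q := by rw [hQ]; field_simp
  have hmean : ∑ s, (∑ x ∈ F.fibre s m, v x) / F.dS = Fintype.card S * Q := by
    rw [← Finset.sum_div, F.sum_sum_fibre hm, hsum, div_eq_iff (by positivity)]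
    linear_combination (-Q) * hcard
  have hle : ∀ s, (∑ x ∈ F.fibre s m, v x) / F.dS ≤ Fintype.card X * Q := fun s => by
    rw [← hsum]
    refine (div_le_self (Finset.sum_nonneg fun x _ => hv x) hS).trans ?_
    exact Finset.sum_le_sum_of_subset_of_nonneg (Finset.subset_univ _) fun x _ _ => hv x
  calc _ ≤ ∑ s, ((∑ x ∈ F.fibre s m, v x) / F.dS * Real.log (Fintype.card X) + Q -
          (∑ x ∈ F.fibre s m, v x) / F.dS) :=
        Finset.sum_le_sum fun s _ => relEntropy_le_mul_log
          (div_nonneg (Finset.sum_nonneg fun x _ => hv x) (by positivity))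
          (div_nonneg (Finset.sum_nonneg fun x _ => hv x) hk.le) (hle s)
    _ = _ := by
        rw [Finset.sum_sub_distrib, Finset.sum_add_distrib, ← Finset.sum_mul, hmean,
          Finset.sum_const, Finset.card_univ, nsmul_eq_mul]
        ring

/-- The seed average of the relative entropy of the fibre mean and the overall mean of `u + v`,
where `u` is bounded and `v` is arbitrary. -/
theorem BRIFunction.sum_relEntropy_fibre_mean_add_le [Nonempty X] (hm : m ∈ F.regSet)
    {u v : X → ℝ} (hu : ∀ x, 0 ≤ u x) (hv : ∀ x, 0 ≤ v x) {B : ℝ} (hB : ∀ x, u x ≤ B) :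
    ∑ s, relEntropy ((∑ x ∈ F.fibre s m, (u x + v x)) / F.dS)
      ((∑ x, (u x + v x)) / Fintype.card X) ≤
      Fintype.card S * (F.lam m * B + (∑ x, v x) / Fintype.card X * Real.log (Fintype.card X)) := by
  have hS : (0 : ℝ) < F.dS := by exact_mod_cast F.dS_pos
  have hk : (0 : ℝ) < Fintype.card X := by exact_mod_cast Fintype.card_pos
  have hac : ∀ w : X → ℝ, (∀ x, 0 ≤ w x) → ∀ s, (∑ x, w x) / Fintype.card X = 0 →
      (∑ x ∈ F.fibre s m, w x) / F.dS = 0 := fun w hw s h => by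
    rw [div_eq_zero_iff, or_iff_left hk.ne', Finset.sum_eq_zero_iff_of_nonneg fun x _ => hw x] at h
    rw [Finset.sum_eq_zero fun x _ => h x (Finset.mem_univ x), zero_div]
  rw [mul_add]
  refine le_trans ?_ (add_le_add (F.sum_relEntropy_fibre_mean_le_lam_mul hm hu hB)
    (F.sum_relEntropy_fibre_mean_le_mul_log hm hv))
  rw [← Finset.sum_add_distrib]
  refine Finset.sum_le_sum fun s _ => ?_
  rw [Finset.sum_add_distrib, Finset.sum_add_distrib, add_div, add_div]
  exact relEntropy_add_le (div_nonneg (Finset.sum_nonneg fun x _ => hu x) hS.le)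
    (div_nonneg (Finset.sum_nonneg fun x _ => hv x) hS.le)
    (div_nonneg (Finset.sum_nonneg fun x _ => hu x) hk.le)
    (div_nonneg (Finset.sum_nonneg fun x _ => hv x) hk.le) (hac u hu s) (hac v hv s)

end BRI

/-! ### Mutual information of messages and seeded outputs -/

section SeededLaw

variable {M S Z : Type*} [Fintype M] [MeasurableSpace Z]

/-- A probability density `g s m` with respect to `ν` of the output for every seed `s` and message
`m`, and message weights `p`. -/
structure IsSeededDensity (ν : Measure Z) (p : M → ℝ≥0∞) (g : S → M → Z → ℝ≥0∞) : Prop where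
  sum_eq_one : ∑ m, p m = 1
  meas : ∀ s m, Measurable (g s m)
  lintegral_eq_one : ∀ s m, ∫⁻ z, g s m z ∂ν = 1

variable {ν : Measure Z} {p : M → ℝ≥0∞} {g : S → M → Z → ℝ≥0∞}

/-- The density of the output given the seed `s`. -/
noncomputable def seedDensity (p : M → ℝ≥0∞) (g : S → M → Z → ℝ≥0∞) (s : S) (z : Z) : ℝ≥0∞ :=
  ∑ m, p m * g s m z

namespace IsSeededDensity


theorem le_one (h : IsSeededDensity ν p g) (m : M) : p m ≤ 1 :=
  h.sum_eq_one ▸ Finset.single_le_sum (fun _ _ => zero_le) (Finset.mem_univ m)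

theorem ne_top (h : IsSeededDensity ν p g) (m : M) : p m ≠ ∞ :=
  ((h.le_one m).trans_lt ENNReal.one_lt_top).ne

theorem ae_ne_top [Fintype S] (h : IsSeededDensity ν p g) : ∀ᵐ z ∂ν, ∀ s m, g s m z ≠ ∞ := by
  refine ae_all_iff.2 fun s => ae_all_iff.2 fun m => ?_
  filter_upwards [ae_lt_top (h.meas s m) (by rw [h.lintegral_eq_one]; simp)] with z hz using hz.ne

theorem measurable_seedDensity (h : IsSeededDensity ν p g) (s : S) :
    Measurable (seedDensity p g s) :=
  Finset.measurable_fun_sum _ fun m _ => (h.meas s m).const_mul _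

theorem seedDensity_ne_top (h : IsSeededDensity ν p g) {z : Z} (hz : ∀ s m, g s m z ≠ ∞) (s : S) :
    seedDensity p g s z ≠ ∞ :=
  ENNReal.sum_ne_top.2 fun m _ => ENNReal.mul_ne_top (h.ne_top m) (hz s m)

theorem isProbabilityMeasure (h : IsSeededDensity ν p g) (s : S) (m : M) :
    IsProbabilityMeasure (ν.withDensity (g s m)) :=
  ⟨by rw [withDensity_apply _ MeasurableSet.univ, setLIntegral_univ, h.lintegral_eq_one]⟩

theorem div_mul_seedDensity (h : IsSeededDensity ν p g) {z : Z} (hz : ∀ s m, g s m z ≠ ∞) (s : S)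
    {m : M} (hm : p m ≠ 0) :
    g s m z / seedDensity p g s z * seedDensity p g s z = g s m z := by
  rcases eq_or_ne (seedDensity p g s z) 0 with h0 | h0
  · have := (Finset.sum_eq_zero_iff.1 h0) m (Finset.mem_univ m)
    rw [h0, mul_zero, (mul_eq_zero.1 this).resolve_left hm]
  · exact ENNReal.div_mul_cancel h0 (h.seedDensity_ne_top hz s)

end IsSeededDensity

variable [Fintype S] [MeasurableSpace M] [MeasurableSpace S] [DiscreteMeasurableSpace M]
  [DiscreteMeasurableSpace S]

/-- The joint law of `(M, (Z, S))`, where `M` has the weights `p`, the seed `S` is uniform and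
independent of `M`, and `Z` has the conditional law `κ s m` given `S = s` and `M = m`. -/
noncomputable def seededLaw (p : M → ℝ≥0∞) (κ : S → M → Measure Z) : Measure (M × (Z × S)) :=
  ∑ m, ∑ s : S, (p m * (Fintype.card S : ℝ≥0∞)⁻¹) •
    (Measure.dirac m).prod ((κ s m).prod (Measure.dirac s))

theorem lintegral_seededLaw (p : M → ℝ≥0∞) (κ : S → M → Measure Z) [∀ s m, SFinite (κ s m)]
    {f : M × (Z × S) → ℝ≥0∞} (hf : Measurable f) :
    ∫⁻ y, f y ∂seededLaw p κ =
      ∑ m, ∑ s, p m * (Fintype.card S : ℝ≥0∞)⁻¹ * ∫⁻ z, f (m, (z, s)) ∂κ s m := by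
  simp only [seededLaw, lintegral_finsetSum_measure, lintegral_smul_measure, smul_eq_mul]
  refine Finset.sum_congr rfl fun m _ => Finset.sum_congr rfl fun s _ => ?_
  rw [lintegral_prod _ hf.aemeasurable, lintegral_dirac,
    lintegral_prod _ (by fun_prop)]
  simp only [lintegral_dirac]

namespace IsSeededDensity

theorem isProbabilityMeasure_seededLaw (h : IsSeededDensity ν p g) [Nonempty S] :
    IsProbabilityMeasure (seededLaw p fun s m => ν.withDensity (g s m)) := by
  have := h.isProbabilityMeasure
  constructor
  rw [← lintegral_one, lintegral_seededLaw _ _ measurable_const]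
  simp only [lintegral_one, measure_univ, mul_one, Finset.sum_const, Finset.card_univ, nsmul_eq_mul]
  rw [← Finset.mul_sum, ← Finset.sum_mul, h.sum_eq_one, one_mul]
  exact ENNReal.mul_inv_cancel (by simp) (by simp)

theorem lintegral_fst_prod_snd (h : IsSeededDensity ν p g) [Nonempty S]
    {f : M × (Z × S) → ℝ≥0∞} (hf : Measurable f) :
    ∫⁻ y, f y ∂((seededLaw p fun s m => ν.withDensity (g s m)).fst.prod
        (seededLaw p fun s m => ν.withDensity (g s m)).snd) =
      ∑ m, ∑ s, p m * (Fintype.card S : ℝ≥0∞)⁻¹ *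
        ∫⁻ z, f (m, (z, s)) * seedDensity p g s z ∂ν := by
  have := h.isProbabilityMeasure
  have := h.isProbabilityMeasure_seededLaw
  have hS : (Fintype.card S : ℝ≥0∞)⁻¹ * Fintype.card S = 1 :=
    ENNReal.inv_mul_cancel (by simp) (by simp)
  rw [lintegral_prod _ hf.aemeasurable, Measure.fst,
    lintegral_map (Measurable.of_discrete) measurable_fst,
    lintegral_seededLaw p (fun s m => ν.withDensity (g s m))
      (f := fun y => ∫⁻ y', f (y.1, y') ∂(seededLaw p fun s m => ν.withDensity (g s m)).snd)
      ((Measurable.of_discrete (f := fun m => ∫⁻ y', f (m, y')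
        ∂(seededLaw p fun s m => ν.withDensity (g s m)).snd)).comp measurable_fst)]
  simp only [lintegral_const, measure_univ, mul_one, Finset.sum_const, Finset.card_univ,
    nsmul_eq_mul]
  refine Finset.sum_congr rfl fun m _ => ?_
  rw [Measure.snd, lintegral_map (by fun_prop) measurable_snd,
    lintegral_seededLaw _ _ (by fun_prop)]
  have e : ∀ m' s, ∫⁻ z, f (m, (z, s)) ∂ν.withDensity (g s m') =
      ∫⁻ z, f (m, (z, s)) * g s m' z ∂ν := fun m' s => by
    rw [lintegral_withDensity_eq_lintegral_mul _ (h.meas s m') (by fun_prop)]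
    simp only [Pi.mul_apply, mul_comm]
  simp only [e]
  have e2 : ∀ s, ∫⁻ z, f (m, (z, s)) * seedDensity p g s z ∂ν =
      ∑ m', p m' * ∫⁻ z, f (m, (z, s)) * g s m' z ∂ν := fun s => by
    simp only [seedDensity, Finset.mul_sum]
    have hm : ∀ m', Measurable fun z => f (m, (z, s)) * g s m' z := fun m' =>
      Measurable.mul (by fun_prop) (h.meas s m')
    rw [lintegral_finsetSum _ fun m' _ => by
      simp only [mul_left_comm (f _)]; exact (hm m').const_mul _]
    refine Finset.sum_congr rfl fun m' _ => ?_
    rw [← lintegral_const_mul _ (hm m')]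
    simp only [mul_left_comm]
  simp only [e2]
  rw [Finset.sum_comm, ← mul_assoc, mul_left_comm, mul_comm (Fintype.card S : ℝ≥0∞), hS, mul_one,
    Finset.mul_sum]
  refine Finset.sum_congr rfl fun s _ => ?_
  rw [Finset.mul_sum, Finset.mul_sum]
  refine Finset.sum_congr rfl fun m' _ => ?_
  ring

/-- The information between the message and the pair of output and seed, in terms of densities. -/
theorem klDiv_seededLaw (h : IsSeededDensity ν p g) [SFinite ν] [Nonempty S] :
    klDiv (seededLaw p fun s m => ν.withDensity (g s m))
      ((seededLaw p fun s m => ν.withDensity (g s m)).fst.prod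
        (seededLaw p fun s m => ν.withDensity (g s m)).snd) =
      ∑ m, ∑ s, p m * (Fintype.card S : ℝ≥0∞)⁻¹ *
        ∫⁻ z, ENNReal.ofReal (relEntropy (g s m z).toReal (seedDensity p g s z).toReal) ∂ν := by
  have := h.isProbabilityMeasure
  have := h.isProbabilityMeasure_seededLaw
  set π := seededLaw p fun s m => ν.withDensity (g s m) with hπ
  let H : M × (Z × S) → ℝ≥0∞ := fun y => g y.2.2 y.1 y.2.1 / seedDensity p g y.2.2 y.2.1
  have hH : Measurable H := by
    refine measurable_from_prod_countable_right fun m => ?_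
    refine measurable_from_prod_countable_left fun s => ?_
    exact (h.meas s m).div (h.measurable_seedDensity s)
  have hdens : π = (π.fst.prod π.snd).withDensity H := by
    refine Measure.ext_of_lintegral _ fun f hf => ?_
    rw [lintegral_withDensity_eq_lintegral_mul _ hH hf, h.lintegral_fst_prod_snd (hH.mul hf),
      hπ, lintegral_seededLaw _ _ hf]
    refine Finset.sum_congr rfl fun m _ => Finset.sum_congr rfl fun s _ => ?_
    rcases eq_or_ne (p m) 0 with hm | hm
    · simp [hm]
    congr 1
    rw [lintegral_withDensity_eq_lintegral_mul _ (h.meas s m) (by fun_prop)]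
    refine lintegral_congr_ae ?_
    filter_upwards [h.ae_ne_top] with z hz
    simp only [Pi.mul_apply, H]
    rw [mul_right_comm, h.div_mul_seedDensity hz s hm]
  have hac : π ≪ π.fst.prod π.snd := by
    conv_lhs => rw [hdens]
    exact withDensity_absolutelyContinuous _ _
  have hrn : π.rnDeriv (π.fst.prod π.snd) =ᵐ[π.fst.prod π.snd] H := by
    have key := Measure.rnDeriv_withDensity (π.fst.prod π.snd) hH
    rwa [← hdens] at key
  rw [klDiv_eq_lintegral_klFun_of_ac hac,
    lintegral_congr_ae (hrn.mono fun y hy => by rw [hy]),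
    h.lintegral_fst_prod_snd (f := fun y => ENNReal.ofReal (klFun (H y).toReal))
      (measurable_klFun.comp (hH.ennreal_toReal)).ennreal_ofReal]
  refine Finset.sum_congr rfl fun m _ => Finset.sum_congr rfl fun s _ => ?_
  congr 1
  refine lintegral_congr_ae ?_
  filter_upwards [h.ae_ne_top] with z hz
  have hfin := h.seedDensity_ne_top hz s
  rw [relEntropy, ENNReal.ofReal_mul ENNReal.toReal_nonneg, ENNReal.ofReal_toReal hfin, mul_comm,
    ← ENNReal.toReal_div]

/-- The information between the message and the pair of output and seed is not decreased when the
output densities given the seed are replaced by an arbitrary function `q` of the output. -/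
theorem klDiv_seededLaw_le (h : IsSeededDensity ν p g) [SFinite ν] [Nonempty S] {q R : Z → ℝ}
    (hq : ∀ᵐ z ∂ν, 0 ≤ q z ∧ (q z = 0 → ∀ s m, g s m z = 0) ∧
      ∀ m, ∑ s, relEntropy (g s m z).toReal (q z) ≤ Fintype.card S * R z) :
    klDiv (seededLaw p fun s m => ν.withDensity (g s m))
      ((seededLaw p fun s m => ν.withDensity (g s m)).fst.prod
        (seededLaw p fun s m => ν.withDensity (g s m)).snd) ≤
      ∫⁻ z, ENNReal.ofReal (R z) ∂ν := by
  rw [h.klDiv_seededLaw]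
  have hmeas : ∀ m s, Measurable fun z =>
      ENNReal.ofReal (relEntropy (g s m z).toReal (seedDensity p g s z).toReal) := fun m s => by
    have h1 := (h.meas s m).ennreal_toReal
    have h2 := (h.measurable_seedDensity s).ennreal_toReal
    exact (h2.mul (measurable_klFun.comp (h1.div h2))).ennreal_ofReal
  simp only [← lintegral_const_mul _ (hmeas _ _)]
  have e : ∀ m, (∑ s, ∫⁻ z, p m * (Fintype.card S : ℝ≥0∞)⁻¹ *
      ENNReal.ofReal (relEntropy (g s m z).toReal (seedDensity p g s z).toReal) ∂ν) =
      ∫⁻ z, ∑ s, p m * (Fintype.card S : ℝ≥0∞)⁻¹ *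
      ENNReal.ofReal (relEntropy (g s m z).toReal (seedDensity p g s z).toReal) ∂ν := fun m =>
    (lintegral_finsetSum _ fun s _ => (hmeas m s).const_mul _).symm
  simp only [e]
  rw [← lintegral_finsetSum _ fun m _ => Finset.measurable_fun_sum _ fun s _ =>
    (hmeas m s).const_mul _]
  refine lintegral_mono_ae ?_
  filter_upwards [h.ae_ne_top, hq] with z hz ⟨hq0, hqac, hqR⟩
  have hcard : (0 : ℝ) < Fintype.card S := by exact_mod_cast Fintype.card_pos
  set P : M → ℝ := fun m => (p m).toReal
  have hP : ∀ m, 0 ≤ P m := fun m => ENNReal.toReal_nonneg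
  have hP1 : ∑ m, P m = 1 := by
    rw [← ENNReal.toReal_sum fun m _ => h.ne_top m, h.sum_eq_one, ENNReal.toReal_one]
  have hbar : ∀ s, (seedDensity p g s z).toReal = ∑ m, P m * (g s m z).toReal := fun s => by
    rw [seedDensity, ENNReal.toReal_sum fun m _ => ENNReal.mul_ne_top (h.ne_top m) (hz s m)]
    simp only [ENNReal.toReal_mul, P]
  have hnn : ∀ s m, 0 ≤ relEntropy (g s m z).toReal (seedDensity p g s z).toReal := fun s m =>
    relEntropy_nonneg ENNReal.toReal_nonneg ENNReal.toReal_nonneg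
  have hw : ∀ m, p m * (Fintype.card S : ℝ≥0∞)⁻¹ =
      ENNReal.ofReal (P m * (Fintype.card S : ℝ)⁻¹) := fun m => by
    rw [ENNReal.ofReal_mul (hP m), ENNReal.ofReal_toReal (h.ne_top m),
      ENNReal.ofReal_inv_of_pos hcard, ENNReal.ofReal_natCast]
  have hwn : ∀ m, 0 ≤ P m * (Fintype.card S : ℝ)⁻¹ := fun m => mul_nonneg (hP m) (by positivity)
  simp only [hw, ← ENNReal.ofReal_mul (hwn _)]
  simp only [← ENNReal.ofReal_sum_of_nonneg fun s _ => mul_nonneg (hwn _) (hnn s _)]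
  rw [← ENNReal.ofReal_sum_of_nonneg fun m _ => Finset.sum_nonneg fun s _ =>
    mul_nonneg (hwn m) (hnn s m)]
  refine ENNReal.ofReal_le_ofReal ?_
  calc _ = (Fintype.card S : ℝ)⁻¹ * ∑ s, ∑ m, P m *
          relEntropy (g s m z).toReal (∑ m, P m * (g s m z).toReal) := by
        rw [Finset.sum_comm, Finset.mul_sum]
        refine Finset.sum_congr rfl fun s _ => ?_
        rw [Finset.mul_sum]
        refine Finset.sum_congr rfl fun m _ => ?_
        rw [hbar]; ring
    _ ≤ (Fintype.card S : ℝ)⁻¹ * ∑ s, ∑ m, P m * relEntropy (g s m z).toReal (q z) := by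
        refine mul_le_mul_of_nonneg_left (Finset.sum_le_sum fun s _ => ?_) (by positivity)
        exact sum_mul_relEntropy_mean_le hP hP1 (fun m => ENNReal.toReal_nonneg) hq0
          fun h0 m => by rw [hqac h0 s m, ENNReal.toReal_zero]
    _ ≤ (Fintype.card S : ℝ)⁻¹ * ∑ m, P m * (Fintype.card S * R z) := by
        rw [Finset.sum_comm]
        gcongr with m
        rw [← Finset.mul_sum]
        exact mul_le_mul_of_nonneg_left (hqR m) (hP m)
    _ = R z := by
        rw [← Finset.sum_mul, hP1]
        field_simp

end IsSeededDensity

end SeededLaw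

/-! ### Leakage of modular schemes -/

section Leakage

variable {S X N A Y Z : Type*} [Fintype S] [Fintype X] [DecidableEq X] [DecidableEq N]
  [MeasurableSpace A] [MeasurableSpace Y] [MeasurableSpace Z]

theorem modularBRIScheme_enc_bind (F : BRIFunction S X N) (c : ECCode X A Y) (U : Kernel A Z)
    {ν : Measure Z} {w : X → Z → ℝ≥0∞} (hw : ∀ x, Measurable (w x))
    (hbind : ∀ x, (c.enc x).bind U = ν.withDensity (w x)) (s : S) (m : N) :
    ((modularBRIScheme F c).enc s m).bind U =
      ν.withDensity fun z => ∑ x ∈ F.fibre s m, (F.dS : ℝ≥0∞)⁻¹ * w x z := by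
  refine Measure.ext fun B hB => ?_
  have e : ∀ x, ((c.enc x).bind U) B = ∫⁻ z in B, w x z ∂ν := fun x => by
    rw [hbind, withDensity_apply _ hB]
  rw [withDensity_apply _ hB, Measure.bind_apply hB U.measurable.aemeasurable,
    lintegral_finsetSum _ fun x _ => (hw x).const_mul _]
  simp only [modularBRIScheme, lintegral_finsetSum_measure, lintegral_smul_measure, smul_eq_mul]
  refine Finset.sum_congr rfl fun x _ => ?_
  rw [lintegral_const_mul _ (hw x), ← e, Measure.bind_apply hB U.measurable.aemeasurable]

/-- The leakage of a modular scheme, when the output densities `u x + v x` with respect to a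
reference measure split into a part `u` bounded by `B` and a remainder `v` of mass at most `ε`. -/
theorem leakage_modularBRIScheme_le [Nonempty X] (F : BRIFunction S X N) (c : ECCode X A Y)
    (U : Kernel A Z) [IsMarkovKernel U] {ν : Measure Z} [IsProbabilityMeasure ν] {u v : X → Z → ℝ≥0∞}
    (hu : ∀ x, Measurable (u x)) (hv : ∀ x, Measurable (v x))
    (hbind : ∀ x, (c.enc x).bind U = ν.withDensity fun z => u x z + v x z)
    {B ε l : ℝ} (hB0 : 0 ≤ B) (hε : 0 ≤ ε) (hl0 : 0 ≤ l) (hB : ∀ x z, u x z ≤ ENNReal.ofReal B)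
    (hvε : ∀ x, ∫⁻ z, v x z ∂ν ≤ ENNReal.ofReal ε) (hl : ∀ m ∈ F.regSet, F.lam m ≤ l) :
    (modularBRIScheme F c).leakage U ≤
      ENNReal.ofReal (l * B + ε * Real.log (Fintype.card X)) / ENNReal.ofReal (Real.log 2) := by
  let _ : MeasurableSpace S := ⊤
  let _ : MeasurableSpace {m // m ∈ (modularBRIScheme F c).msgs} := ⊤
  have : DiscreteMeasurableSpace S := ⟨fun _ => trivial⟩
  have : DiscreteMeasurableSpace {m // m ∈ (modularBRIScheme F c).msgs} := ⟨fun _ => trivial⟩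
  refine iSup_le fun p => ENNReal.div_le_div_right ?_ _
  have hmem : ∀ m : {m // m ∈ (modularBRIScheme F c).msgs}, (m : N) ∈ F.regSet := fun m => m.2
  obtain ⟨x₀⟩ := id ‹Nonempty X›
  obtain ⟨m₀, -⟩ := p.support_nonempty
  have hSne : Nonempty S := by
    have h := F.regular_X m₀ (hmem m₀) x₀
    obtain ⟨s, -⟩ := Finset.card_pos.1 (h ▸ F.dX_pos)
    exact ⟨s⟩
  set g : S → {m // m ∈ (modularBRIScheme F c).msgs} → Z → ℝ≥0∞ :=
    fun s m z => ∑ x ∈ F.fibre s m, (F.dS : ℝ≥0∞)⁻¹ * (u x z + v x z) with hg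
  have henc : ∀ s m, ((modularBRIScheme F c).enc s (m : {m // m ∈ _})).bind U =
      ν.withDensity (g s m) := fun s m =>
    modularBRIScheme_enc_bind F c U (fun x => (hu x).add (hv x)) hbind s m
  have hlaw : (modularBRIScheme F c).jointLaw U p =
      seededLaw p fun s m => ν.withDensity (g s m) := by
    simp only [← henc]
    rfl
  rw [hlaw]
  have hgm : ∀ s m, Measurable (g s m) := fun s m =>
    Finset.measurable_fun_sum _ fun x _ => ((hu x).add (hv x)).const_mul _
  have hdens : IsSeededDensity ν p g := by
    refine ⟨?_, hgm, fun s m => ?_⟩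
    · rw [← tsum_fintype (L := .unconditional _)]; exact p.tsum_coe
    · have h1 := (modularBRIScheme F c).enc_prob s m m.2
      have h2 : IsProbabilityMeasure (((modularBRIScheme F c).enc s m).bind U) := by
        infer_instance
      rw [henc] at h2
      have := h2.measure_univ
      rwa [withDensity_apply _ MeasurableSet.univ, setLIntegral_univ] at this
  have hk : (0 : ℝ) < Fintype.card X := by exact_mod_cast Fintype.card_pos
  have hlog : 0 ≤ Real.log (Fintype.card X) := Real.log_natCast_nonneg _
  have hvfin : ∀ᵐ z ∂ν, ∀ x, v x z ≠ ∞ := ae_all_iff.2 fun x => by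
    filter_upwards [ae_lt_top (hv x) ((hvε x).trans_lt ENNReal.ofReal_lt_top).ne] with z hz
      using hz.ne
  have hufin : ∀ x z, u x z ≠ ∞ := fun x z => ((hB x z).trans_lt ENNReal.ofReal_lt_top).ne
  refine (hdens.klDiv_seededLaw_le
    (q := fun z => (∑ x, ((u x z).toReal + (v x z).toReal)) / Fintype.card X)
    (R := fun z => l * B + (∑ x, (v x z).toReal) / Fintype.card X *
      Real.log (Fintype.card X)) ?_).trans ?_
  · filter_upwards [hvfin] with z hz
    have hxnn : ∀ x, 0 ≤ (u x z).toReal + (v x z).toReal := fun x =>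
      add_nonneg ENNReal.toReal_nonneg ENNReal.toReal_nonneg
    have hgr : ∀ s m, (g s m z).toReal =
        (∑ x ∈ F.fibre s m, ((u x z).toReal + (v x z).toReal)) / F.dS := fun s m => by
      have hd : ((F.dS : ℝ≥0∞)⁻¹) ≠ ∞ := by simp [F.dS_pos.ne']
      rw [hg]
      simp only
      rw [ENNReal.toReal_sum fun x _ =>
        ENNReal.mul_ne_top hd (ENNReal.add_ne_top.2 ⟨hufin x z, hz x⟩), Finset.sum_div]
      refine Finset.sum_congr rfl fun x _ => ?_
      rw [ENNReal.toReal_mul, ENNReal.toReal_add (hufin x z) (hz x), ENNReal.toReal_inv,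
        ENNReal.toReal_natCast]
      ring
    refine ⟨div_nonneg (Finset.sum_nonneg fun x _ => hxnn x) hk.le, fun h0 s m => ?_, fun m => ?_⟩
    · rw [div_eq_zero_iff, or_iff_left hk.ne',
        Finset.sum_eq_zero_iff_of_nonneg fun x _ => hxnn x] at h0
      refine Finset.sum_eq_zero fun x _ => ?_
      have h1 := h0 x (Finset.mem_univ x)
      rw [← ENNReal.toReal_add (hufin x z) (hz x), ENNReal.toReal_eq_zero_iff] at h1
      rw [h1.resolve_right (ENNReal.add_ne_top.2 ⟨hufin x z, hz x⟩), mul_zero]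
    · simp only [hgr]
      refine (F.sum_relEntropy_fibre_mean_add_le (hmem m) (fun x => ENNReal.toReal_nonneg)
        (fun x => ENNReal.toReal_nonneg)
        (fun x => ENNReal.toReal_le_of_le_ofReal hB0 (hB x z))).trans ?_
      gcongr
      exact hl m (hmem m)
  · have hvr : ∀ x, Measurable fun z => ENNReal.ofReal (v x z).toReal := fun x =>
      (hv x).ennreal_toReal.ennreal_ofReal
    have e : ∀ z, ENNReal.ofReal (l * B + (∑ x, (v x z).toReal) / Fintype.card X *
        Real.log (Fintype.card X)) = ENNReal.ofReal (l * B) +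
        ENNReal.ofReal (Real.log (Fintype.card X) / Fintype.card X) *
          ∑ x, ENNReal.ofReal (v x z).toReal := fun z => by
      rw [← ENNReal.ofReal_sum_of_nonneg fun x _ => ENNReal.toReal_nonneg,
        ← ENNReal.ofReal_mul (by positivity), ← ENNReal.ofReal_add (by positivity)
          (mul_nonneg (by positivity) (Finset.sum_nonneg fun x _ => ENNReal.toReal_nonneg))]
      congr 1
      ring
    simp only [e]
    rw [lintegral_add_left measurable_const, lintegral_const, measure_univ, mul_one, lintegral_const_mul _
      (Finset.measurable_fun_sum _ fun x _ => hvr x), lintegral_finsetSum _ fun x _ => hvr x]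
    calc _ ≤ ENNReal.ofReal (l * B) +
          ENNReal.ofReal (Real.log (Fintype.card X) / Fintype.card X) *
            ∑ x : X, ENNReal.ofReal ε := by
          gcongr with x
          exact (lintegral_mono fun z => ENNReal.ofReal_toReal_le).trans (hvε x)
      _ = _ := by
          rw [Finset.sum_const, Finset.card_univ, nsmul_eq_mul, ← ENNReal.ofReal_natCast,
            ← ENNReal.ofReal_mul hk.le, ← ENNReal.ofReal_mul (by positivity),
            ← ENNReal.ofReal_add (by positivity) (by positivity)]
          congr 1
          field_simp

end Leakage

/-! ### Densities of product measures -/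

section PiDensity

variable {ι : Type*} [Fintype ι] {E : ι → Type*} [∀ i, MeasurableSpace (E i)]

theorem lintegral_pi_prod (μ : ∀ i, Measure (E i)) [∀ i, IsProbabilityMeasure (μ i)]
    {f : ∀ i, E i → ℝ≥0∞} (hf : ∀ i, Measurable (f i)) :
    ∫⁻ z, ∏ i, f i (z i) ∂Measure.pi μ = ∏ i, ∫⁻ x, f i x ∂μ i := by
  refine (lintegral_prod_eq_prod_lintegral_of_indepFun Finset.univ
    (fun i (z : ∀ i, E i) => f i (z i)) (iIndepFun_pi fun i => (hf i).aemeasurable)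
    fun i => (hf i).comp (measurable_pi_apply i)).trans ?_
  exact Finset.prod_congr rfl fun i _ => (measurePreserving_eval μ i).lintegral_comp (hf i)

theorem pi_withDensity (μ : ∀ i, Measure (E i)) [∀ i, IsProbabilityMeasure (μ i)]
    {f : ∀ i, E i → ℝ≥0∞} (hf : ∀ i, Measurable (f i))
    [∀ i, SigmaFinite ((μ i).withDensity (f i))] :
    Measure.pi (fun i => (μ i).withDensity (f i)) =
      (Measure.pi μ).withDensity fun z => ∏ i, f i (z i) := by
  refine Measure.pi_eq fun B hB => ?_
  rw [withDensity_apply _ (MeasurableSet.univ_pi hB), ← lintegral_indicator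
    (MeasurableSet.univ_pi hB)]
  have e : ∀ z : ∀ i, E i, (Set.univ.pi B).indicator (fun z => ∏ i, f i (z i)) z =
      ∏ i, (B i).indicator (f i) (z i) := fun z => by
    by_cases hz : z ∈ Set.univ.pi B
    · rw [Set.indicator_of_mem hz]
      exact Finset.prod_congr rfl fun i _ => (Set.indicator_of_mem (hz i trivial) _).symm
    · rw [Set.indicator_of_notMem hz]
      obtain ⟨i, hi⟩ : ∃ i, z i ∉ B i := by simpa [Set.mem_pi] using hz
      exact (Finset.prod_eq_zero (Finset.mem_univ i) (Set.indicator_of_notMem hi _)).symm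
  simp only [e]
  rw [lintegral_pi_prod μ fun i => (hf i).indicator (hB i)]
  refine Finset.prod_congr rfl fun i _ => ?_
  rw [lintegral_indicator (hB i), withDensity_apply _ (hB i)]

end PiDensity

/-! ### Gaussian channels and the information density -/

section Gaussian

/-- The information density, in nats: the logarithm of the density of the normal law with mean `a`
and variance `v` with respect to the centred normal law with variance `w`. -/
noncomputable def infoDensity (v w : ℝ) (a z : ℝ) : ℝ :=
  1 / 2 * Real.log (w / v) - (z - a) ^ 2 / (2 * v) + z ^ 2 / (2 * w)

@[fun_prop]
theorem measurable_infoDensity {α : Type*} [MeasurableSpace α] (v w : ℝ) {f g : α → ℝ}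
    (hf : Measurable f) (hg : Measurable g) : Measurable fun y => infoDensity v w (f y) (g y) := by
  unfold infoDensity
  fun_prop

theorem gaussianPDFReal_eq_exp (μ : ℝ) {v : ℝ≥0} (hv : 0 < v) (x : ℝ) :
    gaussianPDFReal μ v x =
      Real.exp (-(1 / 2) * (Real.log (2 * Real.pi) + Real.log v) - (x - μ) ^ 2 / (2 * v)) := by
  have hv' : (0 : ℝ) < v := hv
  rw [gaussianPDFReal_def, ← Real.log_mul (by positivity) hv'.ne', sub_eq_add_neg, Real.exp_add,
    neg_mul, Real.exp_neg, Real.sqrt_eq_rpow, Real.rpow_def_of_pos (by positivity)]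
  simp only [neg_div]
  ring_nf

variable {v w : ℝ≥0}

theorem gaussianReal_eq_withDensity (hv : 0 < v) (hw : 0 < w) (a : ℝ) :
    gaussianReal a v = (gaussianReal 0 w).withDensity
      fun z => ENNReal.ofReal (Real.exp (infoDensity v w a z)) := by
  have hv' : (0 : ℝ) < v := hv
  have hw' : (0 : ℝ) < w := hw
  rw [gaussianReal_of_var_ne_zero a hv.ne', gaussianReal_of_var_ne_zero 0 hw.ne',
    ← withDensity_mul _ (measurable_gaussianPDF 0 w) (by fun_prop)]
  congr 1
  ext z
  rw [Pi.mul_apply, gaussianPDF, gaussianPDF, ← ENNReal.ofReal_mul (gaussianPDFReal_nonneg _ _ _),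
    gaussianPDFReal_eq_exp a hv, gaussianPDFReal_eq_exp 0 hw, ← Real.exp_add, infoDensity,
    Real.log_div hw'.ne' hv'.ne']
  congr 2
  ring

/-- The cumulant generating function at `θ` of the information density under the normal law with
mean `a` and variance `v`. -/
noncomputable def infoCumulant (v w θ a : ℝ) : ℝ :=
  θ / 2 * Real.log (w / v) + 1 / 2 * Real.log (w / (w + θ * (w - v))) +
    θ * (1 + θ) * a ^ 2 / (2 * (w + θ * (w - v)))

/-- Completing the square: up to a factor, the tilted density is again a normal density. -/
theorem lintegral_exp_infoDensity (hv : 0 < v) (hvw : v ≤ w) {θ : ℝ} (hθ : 0 ≤ θ) (a : ℝ) :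
    ∫⁻ z, ENNReal.ofReal (Real.exp ((1 + θ) * infoDensity v w a z)) ∂gaussianReal 0 w =
      ENNReal.ofReal (Real.exp (infoCumulant v w θ a)) := by
  have hw : 0 < w := hv.trans_le hvw
  have hv' : (0 : ℝ) < v := hv
  have hw' : (0 : ℝ) < w := hw
  have hvw' : (v : ℝ) ≤ w := hvw
  set s : ℝ := w + θ * (w - v) with hs
  have hs0 : 0 < s := by have := mul_nonneg hθ (sub_nonneg.2 hvw'); linarith
  -- the variance and the mean of the tilted law
  let v' : ℝ≥0 := ⟨v * w / s, by positivity⟩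
  have hv'r : (v' : ℝ) = v * w / s := rfl
  have hv'0 : 0 < v' := show (0 : ℝ) < v * w / s by positivity
  rw [gaussianReal_of_var_ne_zero 0 hw.ne', lintegral_withDensity_eq_lintegral_mul _
    (measurable_gaussianPDF 0 w) (by fun_prop)]
  have e : ∀ z, (gaussianPDF 0 w * fun z =>
      ENNReal.ofReal (Real.exp ((1 + θ) * infoDensity v w a z))) z =
      ENNReal.ofReal (Real.exp (infoCumulant v w θ a)) *
        gaussianPDF ((1 + θ) * a * w / s) v' z := fun z => by
    rw [Pi.mul_apply, gaussianPDF, gaussianPDF,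
      ← ENNReal.ofReal_mul (gaussianPDFReal_nonneg _ _ _), ← ENNReal.ofReal_mul (by positivity),
      gaussianPDFReal_eq_exp 0 hw, gaussianPDFReal_eq_exp _ hv'0, ← Real.exp_add, ← Real.exp_add,
      infoDensity, infoCumulant, ← hs, hv'r, Real.log_div hw'.ne' hv'.ne',
      Real.log_div hw'.ne' hs0.ne', Real.log_div (by positivity) hs0.ne',
      Real.log_mul hv'.ne' hw'.ne']
    congr 2
    have q : (1 + θ) * (-(z - a) ^ 2 / (2 * v) + z ^ 2 / (2 * w)) - z ^ 2 / (2 * w) =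
        θ * (1 + θ) * a ^ 2 / (2 * s) -
          (z - (1 + θ) * a * w / s) ^ 2 / (2 * (v * w / s)) := by
      have hs2 : (w : ℝ) + θ * (w - v) ≠ 0 := hs ▸ hs0.ne'
      rw [hs]
      field_simp
      ring
    linear_combination q
  simp only [e]
  rw [lintegral_const_mul _ (measurable_gaussianPDF _ _), lintegral_gaussianPDF_eq_one _ hv'0.ne',
    mul_one]

variable {n : ℕ}

/-- The information density of blocks. -/
noncomputable def blockInfoDensity (v w : ℝ) (a z : Fin n → ℝ) : ℝ :=
  ∑ i, infoDensity v w (a i) (z i)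

theorem measurable_blockInfoDensity {α : Type*} [MeasurableSpace α] (v w : ℝ)
    {f g : α → Fin n → ℝ} (hf : Measurable f) (hg : Measurable g) :
    Measurable fun y => blockInfoDensity v w (f y) (g y) := by
  unfold blockInfoDensity
  fun_prop

theorem gaussianChannel_eq_withDensity (hv : 0 < v) (hw : 0 < w) (a : Fin n → ℝ) :
    gaussianChannel v n a = (gaussianChannel w n 0).withDensity
      fun z => ENNReal.ofReal (Real.exp (blockInfoDensity v w a z)) := by
  have h := gaussianReal_eq_withDensity hv hw
  have : ∀ i, SigmaFinite ((gaussianReal 0 w).withDensity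
      fun z => ENNReal.ofReal (Real.exp (infoDensity v w (a i) z))) := fun i => by
    rw [← h]; infer_instance
  change Measure.pi (fun i => gaussianReal (a i) v) =
    (Measure.pi fun i => gaussianReal 0 w).withDensity _
  simp only [h]
  rw [pi_withDensity (fun _ : Fin n => gaussianReal 0 w)
    (f := fun i z => ENNReal.ofReal (Real.exp (infoDensity v w (a i) z))) fun i => by fun_prop]
  congr 1
  ext z
  rw [blockInfoDensity, Real.exp_sum, ENNReal.ofReal_prod_of_nonneg fun _ _ => (Real.exp_pos _).le]

theorem lintegral_exp_blockInfoDensity (hv : 0 < v) (hvw : v ≤ w) {θ : ℝ} (hθ : 0 ≤ θ)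
    (a : Fin n → ℝ) :
    ∫⁻ z, ENNReal.ofReal (Real.exp ((1 + θ) * blockInfoDensity v w a z))
        ∂gaussianChannel w n 0 =
      ENNReal.ofReal (Real.exp (∑ i, infoCumulant v w θ (a i))) := by
  change ∫⁻ z, _ ∂(Measure.pi fun i => gaussianReal 0 w) = _
  simp only [blockInfoDensity, Finset.mul_sum, Real.exp_sum,
    ENNReal.ofReal_prod_of_nonneg fun _ _ => (Real.exp_pos _).le]
  rw [lintegral_pi_prod (fun _ : Fin n => gaussianReal 0 w)
    (f := fun i z => ENNReal.ofReal (Real.exp ((1 + θ) * infoDensity v w (a i) z)))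
    fun i => by fun_prop]
  exact Finset.prod_congr rfl fun i _ => lintegral_exp_infoDensity hv hvw hθ (a i)

/-- The centred normal law whose variance `w = v + Γ` is that of the channel output for normal
inputs of power `Γ` makes the linear terms in `θ` of the power and of the logarithm cancel. -/
theorem sum_infoCumulant_le (hv : 0 < v) {Γ : ℝ} (hΓ : 0 ≤ Γ) (hw : (w : ℝ) = v + Γ) {θ : ℝ}
    (hθ : 0 ≤ θ) {a : Fin n → ℝ} (ha : ∑ i, a i ^ 2 ≤ n * Γ) :
    ∑ i, infoCumulant v w θ (a i) ≤ n * (θ * (1 / 2 * Real.log (w / v)) + θ ^ 2 / 2) := by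
  have hv' : (0 : ℝ) < v := hv
  have hw' : (0 : ℝ) < w := by rw [hw]; positivity
  have e : (w : ℝ) - v = Γ := by rw [hw]; ring
  simp only [infoCumulant, e]
  have hs0 : 0 < (w : ℝ) + θ * Γ := by positivity
  set s : ℝ := w + θ * Γ with hs
  have hlog : Real.log (w / s) ≤ -(θ * Γ / s) := by
    refine (Real.log_le_sub_one_of_pos (by positivity)).trans (le_of_eq ?_)
    rw [hs]; field_simp; ring
  have hΓs : Γ / s ≤ 1 := by
    rw [div_le_one hs0]
    nlinarith [mul_nonneg hθ hΓ]
  rw [Finset.sum_add_distrib, Finset.sum_const, Finset.card_univ, Fintype.card_fin, nsmul_eq_mul,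
    ← Finset.sum_div, ← Finset.mul_sum]
  have h1 : θ * (1 + θ) * ∑ i, a i ^ 2 ≤ θ * (1 + θ) * (n * Γ) := by gcongr
  calc _ ≤ (n : ℝ) * (θ / 2 * Real.log (w / v) + 1 / 2 * -(θ * Γ / s)) +
        θ * (1 + θ) * (n * Γ) / (2 * s) := by gcongr
    _ = n * (θ * (1 / 2 * Real.log (w / v)) + θ ^ 2 / 2 * (Γ / s)) := by field_simp; ring
    _ ≤ n * (θ * (1 / 2 * Real.log (w / v)) + θ ^ 2 / 2 * 1) := by gcongr
    _ = _ := by ring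

/-- The Chernoff bound for the event that the information density exceeds the capacity by `δ`. -/
theorem lintegral_blockInfoDensity_tail_le (hv : 0 < v) {Γ : ℝ} (hΓ : 0 ≤ Γ)
    (hw : (w : ℝ) = v + Γ) {δ : ℝ} (hδ : 0 ≤ δ) {a : Fin n → ℝ} (ha : ∑ i, a i ^ 2 ≤ n * Γ) :
    ∫⁻ z, (if blockInfoDensity v w a z ≤ n * (1 / 2 * Real.log (w / v) + δ) then 0
        else ENNReal.ofReal (Real.exp (blockInfoDensity v w a z))) ∂gaussianChannel w n 0 ≤
      ENNReal.ofReal (Real.exp (-(n * (δ ^ 2 / 2)))) := by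
  have hvw : v ≤ w := NNReal.coe_le_coe.1 (by rw [hw]; linarith)
  set L := n * (1 / 2 * Real.log (w / v) + δ) with hL
  have hmeas : Measurable fun z : Fin n → ℝ =>
      ENNReal.ofReal (Real.exp ((1 + δ) * blockInfoDensity v w a z)) := by
    unfold blockInfoDensity; fun_prop
  -- the Chernoff exponent `θ = δ` optimizes `θ δ - θ² / 2`
  calc _ ≤ ∫⁻ z, ENNReal.ofReal (Real.exp (-(δ * L))) *
          ENNReal.ofReal (Real.exp ((1 + δ) * blockInfoDensity v w a z))
          ∂gaussianChannel w n 0 := by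
        refine lintegral_mono fun z => ?_
        split_ifs with h
        · exact zero_le
        · rw [← ENNReal.ofReal_mul (by positivity), ← Real.exp_add]
          refine ENNReal.ofReal_le_ofReal (Real.exp_le_exp.2 ?_)
          have := mul_le_mul_of_nonneg_left (not_le.1 h).le hδ
          linarith
    _ = ENNReal.ofReal (Real.exp (-(δ * L) + ∑ i, infoCumulant v w δ (a i))) := by
        rw [lintegral_const_mul _ hmeas, lintegral_exp_blockInfoDensity hv hvw hδ,
          ← ENNReal.ofReal_mul (by positivity), ← Real.exp_add]
    _ ≤ _ := by
        refine ENNReal.ofReal_le_ofReal (Real.exp_le_exp.2 ?_)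
        have := sum_infoCumulant_le hv hΓ hw hδ ha
        rw [hL]
        linarith

instance (v : ℝ≥0) (n : ℕ) : IsMarkovKernel (gaussianChannel v n) :=
  ⟨fun a => inferInstanceAs (IsProbabilityMeasure (Measure.pi fun i => gaussianReal (a i) v))⟩

instance (v : ℝ≥0) (Γ : ℝ) (n : ℕ) : IsMarkovKernel (gaussianChannelOn v Γ n) :=
  inferInstanceAs (IsMarkovKernel ((gaussianChannel v n).comap _ _))

theorem bind_eq_withDensity_add {A Z : Type*} [MeasurableSpace A] [MeasurableSpace Z]
    {κ : Kernel A Z} {ν : Measure Z} [SFinite ν] {φ : Measure A} [SFinite φ]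
    {f g : A × Z → ℝ≥0∞} (hf : Measurable f) (hg : Measurable g)
    (h : ∀ a, κ a = ν.withDensity fun z => f (a, z) + g (a, z)) :
    φ.bind κ = ν.withDensity fun z => ∫⁻ a, f (a, z) ∂φ + ∫⁻ a, g (a, z) ∂φ := by
  refine Measure.ext fun B hB => ?_
  rw [Measure.bind_apply hB κ.measurable.aemeasurable, withDensity_apply _ hB]
  have e : ∀ z, ∫⁻ a, f (a, z) ∂φ + ∫⁻ a, g (a, z) ∂φ = ∫⁻ a, f (a, z) + g (a, z) ∂φ := fun z =>
    (lintegral_add_left (hf.comp measurable_prodMk_right) _).symm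
  simp only [e]
  rw [lintegral_lintegral_swap (f := fun z a => f (a, z) + g (a, z))
    ((hf.add hg).comp measurable_swap).aemeasurable]
  refine lintegral_congr fun a => ?_
  rw [h, withDensity_apply _ hB]

/-- The channel output for any random permissible input has a density with respect to the centred
normal law of variance `v + Γ`, which is bounded by `exp (n (C + δ))`, with the capacity `C`, up
to a part of exponentially small mass.  The two parts are the contributions of the pairs of inputs
and outputs whose information density is at most, or more than, `n (C + δ)`. -/
theorem exists_bind_gaussianChannelOn_eq_withDensity_add (hv : 0 < v) {Γ : ℝ} (hΓ : 0 ≤ Γ)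
    (hw : (w : ℝ) = v + Γ) {δ : ℝ} (hδ : 0 ≤ δ) (φ : Measure (PowerBall Γ n))
    [IsProbabilityMeasure φ] :
    ∃ u r : (Fin n → ℝ) → ℝ≥0∞, Measurable u ∧ Measurable r ∧
      φ.bind (gaussianChannelOn v Γ n) =
        (gaussianChannel w n 0).withDensity (fun z => u z + r z) ∧
      (∀ z, u z ≤ ENNReal.ofReal (Real.exp (n * (1 / 2 * Real.log (w / v) + δ)))) ∧
      ∫⁻ z, r z ∂gaussianChannel w n 0 ≤ ENNReal.ofReal (Real.exp (-(n * (δ ^ 2 / 2)))) := by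
  have hw0 : 0 < w := NNReal.coe_pos.1 (by
    have : (0 : ℝ) < v := hv
    rw [hw]; positivity)
  set L := n * (1 / 2 * Real.log (w / v) + δ) with hL
  let i : PowerBall Γ n × (Fin n → ℝ) → ℝ := fun y => blockInfoDensity v w y.1 y.2
  have hi : Measurable i := measurable_blockInfoDensity v w
    (measurable_subtype_coe.comp measurable_fst) measurable_snd
  have hset : MeasurableSet {y | i y ≤ L} := measurableSet_le hi measurable_const
  have hexp : Measurable fun y => ENNReal.ofReal (Real.exp (i y)) :=
    (Real.measurable_exp.comp hi).ennreal_ofReal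
  let f : PowerBall Γ n × (Fin n → ℝ) → ℝ≥0∞ := fun y =>
    if i y ≤ L then ENNReal.ofReal (Real.exp (i y)) else 0
  let g : PowerBall Γ n × (Fin n → ℝ) → ℝ≥0∞ := fun y =>
    if i y ≤ L then 0 else ENNReal.ofReal (Real.exp (i y))
  have hf : Measurable f := Measurable.ite hset hexp measurable_const
  have hg : Measurable g := Measurable.ite hset measurable_const hexp
  refine ⟨fun z => ∫⁻ a, f (a, z) ∂φ, fun z => ∫⁻ a, g (a, z) ∂φ, hf.lintegral_prod_left',
    hg.lintegral_prod_left', bind_eq_withDensity_add hf hg fun a => ?_, fun z => ?_, ?_⟩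
  · refine (gaussianChannel_eq_withDensity hv hw0 (a : Fin n → ℝ)).trans ?_
    congr 1
    ext z
    simp only [f, g, i]
    split_ifs <;> simp
  · calc ∫⁻ a, f (a, z) ∂φ ≤ ∫⁻ _, ENNReal.ofReal (Real.exp L) ∂φ := by
          refine lintegral_mono fun a => ?_
          simp only [f]
          split_ifs with h
          · exact ENNReal.ofReal_le_ofReal (Real.exp_le_exp.2 h)
          · exact zero_le
      _ = _ := by simp
  · rw [lintegral_lintegral_swap (f := fun z a => g (a, z))
      (hg.comp measurable_swap).aemeasurable]
    calc ∫⁻ a, ∫⁻ z, g (a, z) ∂gaussianChannel w n 0 ∂φ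
        ≤ ∫⁻ _, ENNReal.ofReal (Real.exp (-(n * (δ ^ 2 / 2)))) ∂φ :=
          lintegral_mono fun a => lintegral_blockInfoDensity_tail_le (a := a.1) hv hΓ hw hδ a.2
      _ = _ := by simp

end Gaussian

/-! ### Error probability of modular schemes -/

section Error

variable {S X K N A Y : Type*} [Fintype S] [Fintype X] [DecidableEq X] [DecidableEq N]
  [MeasurableSpace A] [MeasurableSpace Y]

theorem error_modularBRIScheme_restrict_le (F : BRIFunction S X N) (c : ECCode K A Y)
    (T : Kernel A Y) {ι : X → K} {ρ : K → X} (h : Function.LeftInverse ρ ι) :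
    (modularBRIScheme F (c.restrict ι ρ)).error T ≤ c.error T := by
  refine iSup_le fun s => iSup_le fun ⟨m, hm⟩ => ?_
  change m ∈ F.regSet at hm
  have hB : MeasurableSet {y | (modularBRIScheme F (c.restrict ι ρ)).dec s y ≠ m} :=
    c.dec_meas {k | F.f s (ρ k) ≠ m}
  rw [Measure.bind_apply hB T.measurable.aemeasurable]
  simp only [modularBRIScheme, lintegral_finsetSum_measure, lintegral_smul_measure, smul_eq_mul]
  calc _ ≤ ∑ x ∈ Finset.univ.filter (fun x => F.f s x = m), (F.dS : ℝ≥0∞)⁻¹ * c.error T := by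
        refine Finset.sum_le_sum fun x hx => ?_
        gcongr
        refine le_trans ?_ (le_iSup _ (ι x))
        change ∫⁻ a, T a {y | (modularBRIScheme F (c.restrict ι ρ)).dec s y ≠ m} ∂c.enc (ι x) ≤ _
        rw [← Measure.bind_apply hB T.measurable.aemeasurable]
        refine measure_mono fun y hy hdec => hy ?_
        change F.f s (ρ (c.dec y)) = m
        rw [hdec, h x]
        exact (Finset.mem_filter.1 hx).2
    _ = c.error T := by
        rw [Finset.sum_const, F.regular_S m hm s, nsmul_eq_mul, ← mul_assoc,
          ENNReal.mul_inv_cancel (by exact_mod_cast F.dS_pos.ne') (by simp), one_mul]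

end Error

theorem elog2_of_ne_zero {x : ℝ} (hx : x ≠ 0) : elog2 x = (Real.logb 2 x : ℝ) := if_neg hx

/-- A lower bound of the spectral gap exponents of a function whose logarithmic size is `b` bounds
its second eigenvalue moduli. -/
theorem BRIFunction.lam_le_exp {S X N : Type*} [Fintype S] [Fintype X] [DecidableEq X]
    [DecidableEq N] (F : BRIFunction S X N) {t b : ℝ} (hb : 0 < b)
    (h : (t : EReal) < (⨅ m ∈ F.regSet, -elog2 (F.lam m)) / (b : EReal)) {m : N}
    (hm : m ∈ F.regSet) : F.lam m ≤ Real.exp (-(t * (b * Real.log 2))) := by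
  rcases (F.lam_nonneg m).eq_or_lt with h0 | h0
  · rw [← h0]; exact (Real.exp_pos _).le
  have h1 := h.trans_le (EReal.div_le_div_right_of_nonneg (EReal.coe_nonneg.2 hb.le)
    (iInf₂_le m hm))
  rw [elog2_of_ne_zero h0.ne', ← EReal.coe_neg, ← EReal.coe_div, EReal.coe_lt_coe_iff,
    lt_div_iff₀ hb, Real.logb] at h1
  have hlog2 : 0 < Real.log 2 := Real.log_pos one_lt_two
  rw [← neg_div, lt_div_iff₀ hlog2] at h1
  rw [← Real.exp_log h0]
  exact Real.exp_le_exp.2 (by linarith)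

/-! ### Asymptotics -/

section Asymptotics

variable {S X N K : ℕ → Type*} [∀ n, Fintype (S n)] [∀ n, Fintype (X n)]
  [∀ n, Fintype (K n)] {r t : ℝ}

theorem eventually_nonempty_embedding [∀ n, Nonempty (X n)]
    (hX : Tendsto (fun n : ℕ => Real.logb 2 (Fintype.card (X n) : ℝ) / (n : ℝ)) atTop (𝓝 r))
    (hK : (r : EReal) <
      liminf (fun n : ℕ => elog2 (Fintype.card (K n) : ℝ) / (n : EReal)) atTop) :
    ∀ᶠ n in atTop, Nonempty (X n ↪ K n) := by
  obtain ⟨r', hr, hr'⟩ := EReal.lt_iff_exists_real_btwn.1 hK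
  filter_upwards [hX.eventually_lt_const (EReal.coe_lt_coe_iff.1 hr),
    eventually_lt_of_lt_liminf hr', eventually_gt_atTop 0] with n h1 h2 hn
  have hn' : (0 : ℝ) < n := by exact_mod_cast hn
  have hk : (0 : ℝ) < Fintype.card (X n) := by exact_mod_cast Fintype.card_pos
  refine Function.Embedding.nonempty_of_card_le ?_
  have hcast : (n : EReal) = ((n : ℝ) : EReal) := rfl
  rcases eq_or_ne (Fintype.card (K n) : ℝ) 0 with h0 | h0
  · rw [h0, elog2, if_pos rfl, hcast, EReal.bot_div_of_pos_ne_top (EReal.coe_pos.2 hn')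
      (EReal.coe_ne_top _)] at h2
    exact absurd h2 not_lt_bot
  · rw [elog2_of_ne_zero h0, hcast, ← EReal.coe_div, EReal.coe_lt_coe_iff] at h2
    have h3 := (div_lt_div_iff_of_pos_right hn').1 (h1.trans h2)
    have hK0 : (0 : ℝ) < Fintype.card (K n) := lt_of_le_of_ne (Nat.cast_nonneg _) h0.symm
    exact_mod_cast ((Real.logb_lt_logb_iff one_lt_two hk hK0).1 h3).le

theorem eventually_logb_card_pos (hr : 0 < r)
    (hX : Tendsto (fun n : ℕ => Real.logb 2 (Fintype.card (X n) : ℝ) / (n : ℝ)) atTop (𝓝 r)) :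
    ∀ᶠ n in atTop, 0 < Real.logb 2 (Fintype.card (X n) : ℝ) := by
  filter_upwards [hX.eventually_const_lt hr, eventually_gt_atTop 0] with n h hn
  exact (div_pos_iff_of_pos_right (by exact_mod_cast hn)).1 h

theorem tendsto_rate (hr : 0 < r) (ht1 : t < 1) {k : ℕ → ℕ}
    (hX : Tendsto (fun n : ℕ => Real.logb 2 (Fintype.card (X n) : ℝ) / (n : ℝ)) atTop (𝓝 r))
    (hM : Tendsto (fun n : ℕ => Real.logb 2 (k n : ℝ) /
      Real.logb 2 (Fintype.card (X n) : ℝ)) atTop (𝓝 (1 - t))) :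
    Tendsto (fun n : ℕ => elog2 (k n : ℝ) / (n : EReal)) atTop
      (𝓝 (((1 - t) * r : ℝ) : EReal)) := by
  refine (EReal.tendsto_coe.2 (hM.mul hX)).congr' ?_
  filter_upwards [eventually_logb_card_pos hr hX, hM.eventually_const_lt (sub_pos.2 ht1)]
    with n hb hpos
  have hk : (k n : ℝ) ≠ 0 := fun h => by rw [h] at hpos; simp at hpos
  have hcast : (n : EReal) = ((n : ℝ) : EReal) := rfl
  rw [elog2_of_ne_zero hk, hcast, ← EReal.coe_div, div_mul_div_cancel₀ hb.ne']

/-- For large `n`, the leakage of the modular schemes is at most `e^{-nδ} + e^{-nδ²/2} log |X n|`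
nats, where `4δ` is the difference, in nats, of the spectral gap exponent `t r` and the capacity of
the eavesdropper. -/
theorem leakageDecaysExponentially_modularBRIScheme [∀ n, Nonempty (X n)]
    [∀ n, DecidableEq (X n)] [∀ n, DecidableEq (N n)]
    (F : ∀ n, BRIFunction (S n) (X n) (N n))
    (hX : Tendsto (fun n : ℕ => Real.logb 2 (Fintype.card (X n) : ℝ) / (n : ℝ)) atTop (𝓝 r))
    (hlam : (t : EReal) ≤ liminf (fun n : ℕ =>
      (⨅ m ∈ (F n).regSet, -elog2 ((F n).lam m)) /
        ((Real.logb 2 (Fintype.card (X n) : ℝ) : ℝ) : EReal)) atTop)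
    {v : ℝ≥0} (hv : 0 < v) {Γ : ℝ} (hΓ : 0 ≤ Γ) (hr : 0 < r)
    (htr : 1 / 2 * Real.logb 2 (1 + Γ / (v : ℝ)) < t * r)
    (c : ∀ n, ECCode (X n) (PowerBall Γ n) (Fin n → ℝ)) :
    LeakageDecaysExponentially v Γ (fun n => modularBRIScheme (F n) (c n)) := by
  have hlog2 : 0 < Real.log 2 := Real.log_pos one_lt_two
  have hv' : (0 : ℝ) < v := hv
  let w : ℝ≥0 := v + Γ.toNNReal
  have hw : (w : ℝ) = v + Γ := by simp [w, hΓ]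
  set C := 1 / 2 * Real.log (w / v) with hC
  have hCe : C = 1 / 2 * Real.logb 2 (1 + Γ / (v : ℝ)) * Real.log 2 := by
    rw [hC, hw, add_div, div_self hv'.ne', Real.logb]
    field_simp
  set q := r * Real.log 2 with hq
  have hq0 : 0 < q := mul_pos hr hlog2
  have hgap : C < t * q := by
    rw [hCe, hq, ← mul_assoc]
    exact mul_lt_mul_of_pos_right htr hlog2
  obtain ⟨δ, hδ⟩ : ∃ δ, δ = (t * q - C) / 4 := ⟨_, rfl⟩
  have hδ0 : 0 < δ := by rw [hδ]; linarith
  have ht' : ((t - δ / q : ℝ) : EReal) < t :=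
    EReal.coe_lt_coe_iff.2 (sub_lt_self _ (div_pos hδ0 hq0))
  have hXe : Tendsto (fun n : ℕ => Real.log (Fintype.card (X n) : ℝ) / (n : ℝ)) atTop (𝓝 q) := by
    refine (hX.mul_const (Real.log 2)).congr fun n => ?_
    rw [Real.logb]
    field_simp
  have hexp : Tendsto (fun n : ℕ => (t - δ / q) * (Real.log (Fintype.card (X n) : ℝ) / (n : ℝ)))
      atTop (𝓝 (t * q - δ)) := by
    have h := hXe.const_mul (t - δ / q)
    rwa [sub_mul, div_mul_cancel₀ _ hq0.ne'] at h
  set a := min δ (δ ^ 2 / 2) with ha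
  have ha0 : 0 < a := lt_min hδ0 (by positivity)
  -- half of the exponent `a` absorbs the factor linear in `n`
  have hpoly : ∀ᶠ n : ℕ in atTop, (1 + (n : ℝ) * (q + 1)) / Real.log 2 ≤
      Real.exp (n * (a / 2)) := by
    have h1 : Tendsto (fun x : ℝ => ((1 + x * (q + 1)) / Real.log 2) / Real.exp ((a / 2) * x))
        atTop (𝓝 0) := by
      have h2 := (isLittleO_pow_exp_pos_mul_atTop 0 (half_pos ha0)).tendsto_div_nhds_zero
      have h3 := (isLittleO_pow_exp_pos_mul_atTop 1 (half_pos ha0)).tendsto_div_nhds_zero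
      have h4 := (h2.mul_const (Real.log 2)⁻¹).add (h3.mul_const ((q + 1) / Real.log 2))
      simp only [zero_mul, add_zero] at h4
      refine h4.congr fun x => ?_
      field_simp
    filter_upwards [(h1.comp tendsto_natCast_atTop_atTop).eventually_le_const one_pos] with n hn
    have := (div_le_one (Real.exp_pos _)).1 hn
    rwa [mul_comm (a / 2)] at this
  refine ⟨a / 2 / Real.log 2, by positivity, ?_⟩
  filter_upwards [eventually_lt_of_lt_liminf (ht'.trans_le hlam), eventually_logb_card_pos hr hX,
    hexp.eventually_const_lt (show t * q - 2 * δ < t * q - δ by linarith),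
    hXe.eventually_lt_const (show q < q + 1 by linarith), eventually_gt_atTop 0, hpoly]
    with n hn1 hn2 hn3 hn4 hn5 hn6
  have hn : (0 : ℝ) < n := by exact_mod_cast hn5
  have hlogcard : Real.logb 2 (Fintype.card (X n) : ℝ) * Real.log 2 =
      Real.log (Fintype.card (X n)) := by rw [Real.logb]; field_simp
  have hl : ∀ m ∈ (F n).regSet, (F n).lam m ≤ Real.exp (-(n * (t * q - 2 * δ))) := fun m hm => by
    refine ((F n).lam_le_exp hn2 hn1 hm).trans (Real.exp_le_exp.2 ?_)
    rw [hlogcard]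
    rw [← mul_div_assoc, lt_div_iff₀ hn] at hn3
    linarith
  have : ∀ x, IsProbabilityMeasure ((c n).enc x) := (c n).enc_prob
  choose u ρ hu hρ hbind hub hρm using fun x =>
    exists_bind_gaussianChannelOn_eq_withDensity_add hv hΓ hw hδ0.le ((c n).enc x)
  refine (leakage_modularBRIScheme_le (F n) (c n) (gaussianChannelOn v Γ n) hu hρ hbind
    (Real.exp_pos _).le (Real.exp_pos _).le (Real.exp_pos _).le hub hρm hl).trans ?_
  rw [← ENNReal.ofReal_div_of_pos hlog2]
  refine ENNReal.ofReal_le_ofReal ?_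
  have h1 : Real.exp (-(n * (t * q - 2 * δ))) * Real.exp (n * (C + δ)) ≤ Real.exp (-(n * a)) := by
    rw [← Real.exp_add]
    refine Real.exp_le_exp.2 ?_
    have e : -(n * (t * q - 2 * δ)) + n * (C + δ) = -(n * δ) := by rw [hδ]; ring
    rw [e]
    exact neg_le_neg (mul_le_mul_of_nonneg_left (min_le_left _ _) hn.le)
  have h2 : Real.exp (-(n * (δ ^ 2 / 2))) * Real.log (Fintype.card (X n)) ≤
      Real.exp (-(n * a)) * (n * (q + 1)) := by
    refine mul_le_mul (Real.exp_le_exp.2 (neg_le_neg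
      (mul_le_mul_of_nonneg_left (min_le_right _ _) hn.le))) ?_ (Real.log_natCast_nonneg _)
      (Real.exp_pos _).le
    rw [div_lt_iff₀ hn] at hn4
    linarith
  calc _ ≤ (Real.exp (-(n * a)) + Real.exp (-(n * a)) * (n * (q + 1))) / Real.log 2 := by
        gcongr
    _ = Real.exp (-(n * a)) * ((1 + n * (q + 1)) / Real.log 2) := by ring
    _ ≤ Real.exp (-(n * a)) * Real.exp (n * (a / 2)) := by gcongr
    _ = 2 ^ (-(a / 2 / Real.log 2 * n)) := by
        rw [← Real.exp_add, Real.rpow_def_of_pos two_pos]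
        congr 1
        field_simp
        ring

theorem LeakageDecaysExponentially.tendsto_zero {v : ℝ≥0} {Γ : ℝ}
    {c : ∀ n, SeededCode (S n) (N n) (PowerBall Γ n) (Fin n → ℝ)}
    (h : LeakageDecaysExponentially v Γ c) :
    Tendsto (fun n => (c n).leakage (gaussianChannelOn v Γ n)) atTop (𝓝 0) := by
  obtain ⟨κ, hκ, h⟩ := h
  have h1 : Tendsto (fun n : ℕ => ENNReal.ofReal ((2 : ℝ) ^ (-(κ * (n : ℝ))))) atTop (𝓝 0) := by
    rw [← ENNReal.ofReal_zero]
    refine ENNReal.tendsto_ofReal ?_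
    refine (tendsto_rpow_atBot_of_base_gt_one 2 one_lt_two).comp ?_
    exact tendsto_neg_atTop_atBot.comp (tendsto_natCast_atTop_atTop.const_mul_atTop hκ)
  exact tendsto_of_tendsto_of_tendsto_of_le_of_le' tendsto_const_nhds h1
    (Eventually.of_forall fun _ => zero_le) h

end Asymptotics

end Wiretap

theorem mainTheorem8
    (r t : ℝ) (hr : 0 ≤ r) (ht0 : 0 ≤ t) (ht1 : t < 1)
    {S X N : ℕ → Type*} [∀ n, Fintype (S n)] [∀ n, Fintype (X n)] [∀ n, Nonempty (X n)]
    [∀ n, DecidableEq (X n)] [∀ n, DecidableEq (N n)]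
    (F : ∀ n, Wiretap.BRIFunction (S n) (X n) (N n))
    (hX : Tendsto (fun n : ℕ => Real.logb 2 (Fintype.card (X n) : ℝ) / (n : ℝ)) atTop (𝓝 r))
    (hM : Tendsto (fun n : ℕ => Real.logb 2 ((F n).regSet.card : ℝ) /
      Real.logb 2 (Fintype.card (X n) : ℝ)) atTop (𝓝 (1 - t)))
    (hlam : (t : EReal) ≤ liminf (fun n : ℕ =>
      (⨅ m ∈ (F n).regSet, -Wiretap.elog2 ((F n).lam m)) /
        ((Real.logb 2 (Fintype.card (X n) : ℝ) : ℝ) : EReal)) atTop)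
    (vT vU : ℝ≥0) (hvT : 0 < vT) (hvU : 0 < vU) (Γ : ℝ) (hΓ : 0 ≤ Γ)
    {K : ℕ → Type*} [∀ n, Fintype (K n)]
    (c : ∀ n, Wiretap.ECCode (K n) (Wiretap.PowerBall Γ n) (Fin n → ℝ))
    (hc : Wiretap.AchievesRateAbove vT Γ c r)
    (htr : 1 / 2 * Real.logb 2 (1 + Γ / (vU : ℝ)) < t * r) :
    (∀ᶠ n in atTop, Nonempty (X n ↪ K n)) ∧
    ∀ (ι : ∀ n, X n → K n) (ρ : ∀ n, K n → X n),
      (∀ᶠ n in atTop, Function.LeftInverse (ρ n) (ι n)) →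
      Wiretap.AchievesSemSecRate vT vU Γ
        (fun n => Wiretap.modularBRIScheme (F n) ((c n).restrict (ι n) (ρ n))) ((1 - t) * r) ∧
      Wiretap.LeakageDecaysExponentially vU Γ
        (fun n => Wiretap.modularBRIScheme (F n) ((c n).restrict (ι n) (ρ n))) := by
  -- the capacity of the eavesdropper is nonnegative, so that `r = 0` is excluded
  have hr0 : 0 < r := by
    have h : 0 ≤ Real.logb 2 (1 + Γ / (vU : ℝ)) :=
      Real.logb_nonneg one_lt_two (le_add_of_nonneg_right (by positivity))
    refine hr.lt_of_ne fun h0 => ?_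
    rw [← h0, mul_zero] at htr
    linarith
  refine ⟨Wiretap.eventually_nonempty_embedding hX hc.1, fun ι ρ hιρ => ?_⟩
  have hleak := Wiretap.leakageDecaysExponentially_modularBRIScheme F hX hlam hvU hΓ hr0 htr
    fun n => (c n).restrict (ι n) (ρ n)
  refine ⟨⟨(Wiretap.tendsto_rate hr0 ht1 hX hM).liminf_eq.ge, ?_, hleak.tendsto_zero⟩, hleak⟩
  exact tendsto_of_tendsto_of_tendsto_of_le_of_le' tendsto_const_nhds hc.2
    (Eventually.of_forall fun _ => zero_le) (hιρ.mono fun n h =>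
      Wiretap.error_modularBRIScheme_restrict_le (F n) (c n) _ h)
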